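/- **Setting.** For each $n$ a probability law $P_n$ of the sample is given (the law under the true parameters). Write $\theta=(\pi,\beta)\in\mathbb R^{d_\pi}\times\mathbb R^{d_\beta}$; $\Theta$ is the parameter space, $\breve\Theta\supseteq\Theta$ is open, $Q_n(\theta)$ is a real data-dependent function on $\breve\Theta$, and the true parameters satisfy $\theta_n=(\pi_n,\beta_n)\in\Theta$, $\theta_n\to\theta_*=(\pi_*,\beta_*)$. Let $\mathcal B(\Pi)=\{\beta:(\pi,\beta)\in\Theta\text{ for some }\pi\in\Pi\}$, $\mathcal B(\pi)=\mathcal B(\{\pi\})$, $\mathcal B_*=\mathcal B(\pi_*)$. Given $r_1(\pi)\in\mathbb R^{d_{r_1}}$, $r_2(\beta)\in\mathbb R^{d_{r_2}}$, let $\Theta^r=\{(\pi,\beta)\in\Theta: r_1(\pi)=0,\ r_2(\beta)=0\}$, $\mathcal B^r(\pi)=\{\beta\in\mathcal B(\pi): r_2(\beta)=0\}$, $\mathcal B^r_*=\mathcal B^r(\pi_*)$, and $$QLR_n=2n\Big(\inf_{\theta\in\Theta^r}Q_n(\theta)-\inf_{\theta\in\Theta}Q_n(\theta)\Big).$$ $d_H$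 is the Hausdorff distance, $\vec d(A,B)=\sup_{a\in A}\inf_{b\in B}\|a-b\|$ (zero if $A=\emptyset$), and $A_n\to_K A$ (Kuratowski convergence) means $\max(\vec d(A_n\cap K,A),\vec d(A\cap K,A_n))\to0$ for every compact $K$. $\mathcal B_1$ denotes $\mathcal B(\Pi_1)$ for some neighbourhood $\Pi_1$ of $\pi_*$. **Assumptions.** 1. $\tau:\breve\Theta\to\mathbb R^{d_\tau}$ is twice continuously differentiable; $\delta(\pi,\beta)=(\pi,\tau(\pi,\beta))$, $\delta_n=\delta(\theta_n)$, $\delta_*=\delta(\theta_*)$. 2. $T_n$ is a data-dependent real function that is almost surely twice differentiable on $\delta(\breve\Theta)$, with (a) $\sup_{\theta\in\breve\Theta}|Q_n(\theta)-T_n(\delta(\theta))|=o_p(1)$ and (b) for all positive $\eta_n\to0$, $\sup_{\theta\in\breve\Theta:\|\delta(\theta)-\delta_n\|\le\eta_n}|Q_n(\theta)-T_n(\delta(\theta))|/(1+\sqrt n\|\delta(\theta)-\delta_n\|)^2=o_p(n^{-1})$. 3. There is a nonrandom $T$, continuous on $\delta(\breve\Theta)$, with (a) $\sup_{\delta\in\delta(\breve\Theta)}|T_n(\delta)-T(\delta)|\to_p0$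 and (b) $\inf_{\delta\in\delta(\breve\Theta)\setminus U}T(\delta)>T(\delta_*)$ for every neighbourhood $U$ of $\delta_*$. 4. (a) $\Theta$ is closed and $\mathcal B_*$ is compact; (b) for some $M>0$, $d_H(\mathcal B(\pi_1),\mathcal B(\pi_2))\le M\|\pi_1-\pi_2\|$ for all $\pi_1,\pi_2$ in a neighbourhood of $\pi_*$. 5(S) (strong). If $\beta\in\mathcal B_*$ and $\tau(\pi_*,\beta)=\tau(\pi_*,\beta_*)$ then $\beta=\beta_*$; and $C:=\partial_\beta\tau(\theta_*)$ has rank $d_\beta$. Put $a_n=1$. 5(SS) (semi-strong). There are $a_n>0$ with $a_n\to\infty$, $n^{-1/2}a_n\to0$, such that (a) $a_n(\tau(\pi_n,\beta)-\tau(\pi_n,\beta_n))\to c(\beta)$ uniformly over $\beta\in\mathcal B_1$, where $c(\beta)=0$ implies $\beta=\beta_*$; and (b) $a_n\partial_\beta\tau(\pi_n,\beta)\to C(\beta)$ uniformly over $\beta$ in a neighbourhood of $\beta_*$, where $C:=C(\beta_*)$ has rank $d_\beta$. 5(W) (weak). $\sqrt n(\tau(\pi_n,\beta)-\tau(\pi_n,\beta_n))\to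 c(\beta)$ uniformly over $\beta\in\mathcal B_1$. Put $a_n=\sqrt n$. 6. With $R_n(\delta)=T_n(\delta)-T_n(\delta_n)-\partial_\delta T_n(\delta_n)'(\delta-\delta_n)-\frac12(\delta-\delta_n)'\partial_{\delta\delta}T_n(\delta_n)(\delta-\delta_n)$, for all positive $\eta_n\to0$, $\sup_{\delta\in\delta(\breve\Theta):\|\delta-\delta_n\|\le\eta_n}|nR_n(\delta)|/(1+\sqrt n\|\delta-\delta_n\|)^2=o_p(1)$. 7. (a) $\sqrt n\,\partial_\delta T_n(\delta_n)\to_dY\sim N(0,V)$ and (b) $\partial_{\delta\delta}T_n(\delta_n)\to_pH$, with $V,H$ symmetric positive definite. 8(a). For a closed set $\Psi\subseteq\mathbb R^{d_\pi+d_\beta}$, $\{(\sqrt n(\pi-\pi_n),\sqrt n(\beta-\beta_n)/a_n):(\pi,\beta)\in\Theta\}\to_K\Psi$. 10. (a) $r(\pi,\beta)=(r_1(\pi),r_2(\beta))$ is continuously differentiable on $\breve\Theta$ and $R_1:=\partial_\pi r_1(\pi_*)$ has rank $d_{r_1}$. (b) For every $\beta$ with $(\pi,\beta)\in\Theta$ for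 some $\pi$, $r_2(\beta)=0$ implies $\beta=\beta_*$. (c) For some $M>0$, $d_H(\mathcal B^r(\pi_1),\mathcal B^r(\pi_2))\le M\|\pi_1-\pi_2\|$ for all $\pi_1,\pi_2$ in a neighbourhood of $\pi_*$ with $r_1(\pi_1)=r_1(\pi_2)=0$. (d) For a closed set $\Psi^r$, $\{(\sqrt n(\pi-\pi_n),\sqrt n(\beta-\beta_n)/a_n):(\pi,\beta)\in\Theta^r\}\to_K\Psi^r$. **Limits.** $D_*=\begin{pmatrix}I&0\\\partial_\pi\tau(\theta_*)&C\end{pmatrix}$, $J=D_*'HD_*$, $Z=-J^{-1}D_*'Y$; $D_1(\theta)=\begin{pmatrix}I\\\partial_\pi\tau(\theta)\end{pmatrix}$, $J_{11}(\beta)=D_1(\pi_*,\beta)'HD_1(\pi_*,\beta)$, $g(\beta)=(0,c(\beta))$, $Z_1(\beta)=-J_{11}(\beta)^{-1}D_1(\pi_*,\beta)'(Y+Hg(\beta))$, $$\tilde q^W(\beta)=\tfrac12g(\beta)'Hg(\beta)+Y'g(\beta)-\tfrac12Z_1(\beta)'J_{11}(\beta)Z_1(\beta),$$ $$\tilde q^{W,r}(\beta)=\tilde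 q^W(\beta)+\tfrac12Z_1(\beta)'R_1'(R_1J_{11}(\beta)^{-1}R_1')^{-1}R_1Z_1(\beta).$$ **Theorem 2.** Suppose assumptions 1, 2, 3, 4, 6 and 7 hold and $r(\theta_n)=0$ for all $n$. (a) Under 5(S), 8(a) and 10(d), and (b) under 5(SS), 8(a) and 10(a,(b or c),d), $$QLR_n\to_d\inf_{\psi\in\Psi^r}(Z-\psi)'J(Z-\psi)-\inf_{\psi\in\Psi}(Z-\psi)'J(Z-\psi).$$ (c) Under 5(W) and 10(b,d), $$QLR_n\to_d QLR^{W1}_*=\inf_{(\psi_1,\psi_2)\in\Psi^r}(Z_1(\beta_*)-\psi_1)'J_{11}(\beta_*)(Z_1(\beta_*)-\psi_1)-Z_1(\beta_*)'J_{11}(\beta_*)Z_1(\beta_*)-\inf_{\beta\in\mathcal B_*}2\tilde q^W(\beta).$$ (d) Under 5(W) and 10(a,c), $$QLR_n\to_d QLR^{W2}_*=\inf_{\beta\in\mathcal B^r_*}2\tilde q^{W,r}(\beta)-\inf_{\beta\in\mathcal B_*}2\tilde q^W(\beta).$$ -/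

import Mathlib

open MeasureTheory ProbabilityTheory Filter Topology Set
open scoped ENNReal Matrix

noncomputable section

namespace QLRLimit

/-- Column vectors of length `d`, with the Euclidean norm. -/
abbrev Vec (d : ℕ) := EuclideanSpace ℝ (Fin d)

/-- Stacked column vectors `(a, b)` of lengths `d` and `e`, with the Euclidean norm. -/
abbrev Vec₂ (d e : ℕ) := EuclideanSpace ℝ (Fin d ⊕ Fin e)

/-- Stacking of two column vectors. -/
def stack {d e : ℕ} (a : Vec d) (b : Vec e) : Vec₂ d e :=
  WithLp.toLp 2 (Sum.elim a.ofLp b.ofLp)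

/-! ### Derivatives as vectors and matrices -/

/-- The matrix of first derivatives of a vector-valued function. -/
def jacobian {d e : ℕ} (f : Vec d → Vec e) (x : Vec d) : Matrix (Fin e) (Fin d) ℝ :=
  Matrix.of fun i j => fderiv ℝ f x (EuclideanSpace.single j 1) i

/-- The matrix of second derivatives of a real-valued function. -/
def hessian {ι : Type*} [Fintype ι] [DecidableEq ι] (f : EuclideanSpace ℝ ι → ℝ)
    (x : EuclideanSpace ℝ ι) : Matrix ι ι ℝ :=
  Matrix.of fun i j =>
    fderiv ℝ (fderiv ℝ f) x (EuclideanSpace.single i 1) (EuclideanSpace.single j 1)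

/-- `f` is twice differentiable at `x`. -/
def TwiceDifferentiableAt {ι : Type*} [Fintype ι] (f : EuclideanSpace ℝ ι → ℝ)
    (x : EuclideanSpace ℝ ι) : Prop :=
  (∀ᶠ y in 𝓝 x, DifferentiableAt ℝ f y) ∧ DifferentiableAt ℝ (fderiv ℝ f) x

/-- The quadratic form `v' A v`. -/
def quad {ι : Type*} [Fintype ι] (A : Matrix ι ι ℝ) (v : ι → ℝ) : ℝ := v ⬝ᵥ (A *ᵥ v)

/-! ### Set distances and set limits -/

/-- The directed distance `sup_{a ∈ A} inf_{b ∈ B} d(a, b)` (zero when `A` is empty, infinite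
when `B` is empty and `A` is not). -/
def dirDist {X : Type*} [PseudoEMetricSpace X] (A B : Set X) : ℝ≥0∞ :=
  ⨆ a ∈ A, Metric.infEDist a B

/-- Kuratowski convergence of the sets `A n` to the set `B`. -/
def KuratowskiTendsto {X : Type*} [PseudoEMetricSpace X] (A : ℕ → Set X) (B : Set X) : Prop :=
  ∀ K : Set X, IsCompact K →
    Tendsto (fun n => max (dirDist (A n ∩ K) B) (dirDist (B ∩ K) (A n))) atTop (𝓝 0)

/-! ### Convergence in probability along a sequence of probability spaces -/

/-- `X n = o_p(1)` under the laws `P n`, for nonnegative extended-real `X n`. For events that are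
not measurable, `P n` is the outer probability. -/
def ToZeroInProb {Ω : ℕ → Type*} [∀ n, MeasurableSpace (Ω n)] (P : ∀ n, Measure (Ω n))
    (X : ∀ n, Ω n → ℝ≥0∞) : Prop :=
  ∀ ε : ℝ≥0∞, 0 < ε → Tendsto (fun n => P n {ω | ε < X n ω}) atTop (𝓝 0)

/-! ### The model -/

section Model

variable {dp db dt k₁ k₂ : ℕ}

/-- The link function `δ(π, β) = (π, τ(π, β))`. -/
def link (τ : Vec dp × Vec db → Vec dt) (θ : Vec dp × Vec db) : Vec₂ dp dt :=
  stack θ.1 (τ θ)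

/-- The `d_τ × d_π` matrix of derivatives of `τ` with respect to `π`. -/
def dτπ (τ : Vec dp × Vec db → Vec dt) (θ : Vec dp × Vec db) : Matrix (Fin dt) (Fin dp) ℝ :=
  jacobian (fun p => τ (p, θ.2)) θ.1

/-- The `d_τ × d_β` matrix of derivatives of `τ` with respect to `β`. -/
def dτβ (τ : Vec dp × Vec db → Vec dt) (θ : Vec dp × Vec db) : Matrix (Fin dt) (Fin db) ℝ :=
  jacobian (fun b => τ (θ.1, b)) θ.2

/-- The cross-section `B(Π)` of the parameter space `Θ`. -/
def crossSec (Θ : Set (Vec dp × Vec db)) (S : Set (Vec dp)) : Set (Vec db) :=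
  {β | ∃ π ∈ S, (π, β) ∈ Θ}

/-- The restricted cross-section `B^r(π) = {β ∈ B(π) | r₂(β) = 0}`. -/
def crossSecR (Θ : Set (Vec dp × Vec db)) (r₂ : Vec db → Vec k₂) (π : Vec dp) : Set (Vec db) :=
  {β ∈ crossSec Θ {π} | r₂ β = 0}

/-- The restricted parameter space `Θ^r = {(π, β) ∈ Θ | r₁(π) = 0, r₂(β) = 0}`. -/
def restricted (Θ : Set (Vec dp × Vec db)) (r₁ : Vec dp → Vec k₁) (r₂ : Vec db → Vec k₂) :
    Set (Vec dp × Vec db) :=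
  {θ ∈ Θ | r₁ θ.1 = 0 ∧ r₂ θ.2 = 0}

/-- The localized parameter space `{(√n (π - π₀), √n (β - β₀) / a) | (π, β) ∈ S}`. -/
def localSet (n : ℕ) (a : ℝ) (θ₀ : Vec dp × Vec db) (S : Set (Vec dp × Vec db)) :
    Set (Vec₂ dp db) :=
  (fun θ => stack (√(n : ℝ) • (θ.1 - θ₀.1)) ((√(n : ℝ) / a) • (θ.2 - θ₀.2))) '' S

/-- `QLR_n = 2 n (inf_{Θ^r} Q_n - inf_Θ Q_n)`, for one realization `q` of `Q_n`. -/
def qlr (n : ℕ) (q : Vec dp × Vec db → ℝ) (Θ Θr : Set (Vec dp × Vec db)) : ℝ :=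
  2 * n * (sInf (q '' Θr) - sInf (q '' Θ))

/-! ### Assumptions on the parameter space and on the restrictions -/

/-- `Θ` is closed, `B_* = B(π_*)` is compact, and `π ↦ B(π)` is Lipschitz in the Hausdorff
distance near `π_*`. -/
def RegularParamSpace (Θ : Set (Vec dp × Vec db)) (πs : Vec dp) : Prop :=
  IsClosed Θ ∧ IsCompact (crossSec Θ {πs}) ∧
    ∃ M : ℝ, 0 < M ∧ ∃ U ∈ 𝓝 πs, ∀ π₁ ∈ U, ∀ π₂ ∈ U,
      Metric.hausdorffEDist (crossSec Θ {π₁}) (crossSec Θ {π₂}) ≤ ENNReal.ofReal (M * ‖π₁ - π₂‖)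

/-- `r = (r₁, r₂)` is continuously differentiable (on the open set `Θo` around the parameter
space), and `R₁ = ∂r₁(π_*)` has full row rank. -/
def RegularRestriction (Θo : Set (Vec dp × Vec db)) (r₁ : Vec dp → Vec k₁)
    (r₂ : Vec db → Vec k₂) (πs : Vec dp) : Prop :=
  ContDiffOn ℝ 1 (fun θ : Vec dp × Vec db => (r₁ θ.1, r₂ θ.2)) Θo ∧
    (jacobian r₁ πs).rank = k₁

/-- No nuisance component of `β` is left free by the null: `r₂(β) = 0` implies `β = β_*`, for every
`β` that occurs in the parameter space. -/
def NullPinsBeta (Θ : Set (Vec dp × Vec db)) (r₂ : Vec db → Vec k₂) (βs : Vec db) : Prop :=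
  ∀ β ∈ crossSec Θ univ, r₂ β = 0 → β = βs

/-- The restricted cross-sections are Lipschitz in the Hausdorff distance near `π_*`, among the `π`
with `r₁(π) = 0`. -/
def LipschitzNullCrossSec (Θ : Set (Vec dp × Vec db)) (r₁ : Vec dp → Vec k₁)
    (r₂ : Vec db → Vec k₂) (πs : Vec dp) : Prop :=
  ∃ M : ℝ, 0 < M ∧ ∃ U ∈ 𝓝 πs, ∀ π₁ ∈ U, ∀ π₂ ∈ U, r₁ π₁ = 0 → r₁ π₂ = 0 →
    Metric.hausdorffEDist (crossSecR Θ r₂ π₁) (crossSecR Θ r₂ π₂) ≤ ENNReal.ofReal (M * ‖π₁ - π₂‖)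

/-- The localized sets of `S` around `θ n`, with weakness `a n`, converge in the sense of
Kuratowski to the closed set `Ψ`. -/
def LocalLimit (S : Set (Vec dp × Vec db)) (θ : ℕ → Vec dp × Vec db) (a : ℕ → ℝ)
    (Ψ : Set (Vec₂ dp db)) : Prop :=
  IsClosed Ψ ∧ KuratowskiTendsto (fun n => localSet n (a n) (θ n) S) Ψ

/-! ### The three types of sequences -/

/-- Strong identification. -/
def StrongSeq (Θ : Set (Vec dp × Vec db)) (τ : Vec dp × Vec db → Vec dt)
    (θs : Vec dp × Vec db) : Prop :=
  (∀ β ∈ crossSec Θ {θs.1}, τ (θs.1, β) = τ θs → β = θs.2) ∧ (dτβ τ θs).rank = db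

/-- Semi-strong identification, with weakness `a n → ∞`, `a n / √n → 0`, and limit derivative
`Cf`. Convergence of `τ` is uniform over `B(S)` for some neighbourhood `S` of `π_*`. -/
def SemiStrongSeq (Θ : Set (Vec dp × Vec db)) (τ : Vec dp × Vec db → Vec dt)
    (θ : ℕ → Vec dp × Vec db) (θs : Vec dp × Vec db) (a : ℕ → ℝ)
    (Cf : Vec db → Matrix (Fin dt) (Fin db) ℝ) : Prop :=
  (∀ n, 0 < a n) ∧ Tendsto a atTop atTop ∧
    Tendsto (fun n : ℕ => a n / √(n : ℝ)) atTop (𝓝 0) ∧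
    (∃ c : Vec db → Vec dt, ∃ S ∈ 𝓝 θs.1,
      TendstoUniformlyOn (fun n β => a n • (τ ((θ n).1, β) - τ (θ n))) c atTop (crossSec Θ S) ∧
      ∀ β ∈ crossSec Θ S, c β = 0 → β = θs.2) ∧
    (∃ U ∈ 𝓝 θs.2,
      TendstoUniformlyOn (fun n β => a n • dτβ τ ((θ n).1, β)) Cf atTop U) ∧
    (Cf θs.2).rank = db

/-- Weak identification, with limit `c`, uniformly over `B(S)` for some neighbourhood `S` of `π_*`. -/
def WeakSeq (Θ : Set (Vec dp × Vec db)) (τ : Vec dp × Vec db → Vec dt)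
    (θ : ℕ → Vec dp × Vec db) (θs : Vec dp × Vec db) (c : Vec db → Vec dt) : Prop :=
  ∃ S ∈ 𝓝 θs.1, TendstoUniformlyOn
    (fun (n : ℕ) β => √(n : ℝ) • (τ ((θ n).1, β) - τ (θ n))) c atTop (crossSec Θ S)

/-! ### Assumptions on the objective function -/

section Objective

variable {Ω : ℕ → Type*} [∀ n, MeasurableSpace (Ω n)]

/-- `Q_n(θ)` depends on `θ` approximately only through `δ(θ)`: `T_n` is almost surely twice
differentiable on `δ(Θo)`, `sup |Q_n - T_n ∘ δ| = o_p(1)`, and locally the difference is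
`o_p(n⁻¹)` relative to `(1 + √n ‖δ(θ) - δ(θ_n)‖)²`. -/
def ReducedFormObjective (P : ∀ n, Measure (Ω n)) (Θo : Set (Vec dp × Vec db))
    (τ : Vec dp × Vec db → Vec dt) (θ : ℕ → Vec dp × Vec db)
    (Q : ∀ n, Ω n → Vec dp × Vec db → ℝ) (T : ∀ n, Ω n → Vec₂ dp dt → ℝ) : Prop :=
  (∀ n, ∀ᵐ ω ∂(P n), ∀ δ ∈ link τ '' Θo, TwiceDifferentiableAt (T n ω) δ) ∧
  ToZeroInProb P (fun (n : ℕ) ω => ⨆ t ∈ Θo, ENNReal.ofReal |Q n ω t - T n ω (link τ t)|) ∧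
  ∀ η : ℕ → ℝ, (∀ n, 0 < η n) → Tendsto η atTop (𝓝 0) →
    ToZeroInProb P (fun (n : ℕ) ω => ⨆ t ∈ {t ∈ Θo | ‖link τ t - link τ (θ n)‖ ≤ η n},
      ENNReal.ofReal (n * |Q n ω t - T n ω (link τ t)| /
        (1 + √(n : ℝ) * ‖link τ t - link τ (θ n)‖) ^ 2))

/-- The reduced-form parameters are identified by the probability limit of `T_n`. -/
def ReducedFormIdentified (P : ∀ n, Measure (Ω n)) (Θo : Set (Vec dp × Vec db))
    (τ : Vec dp × Vec db → Vec dt) (θs : Vec dp × Vec db)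
    (T : ∀ n, Ω n → Vec₂ dp dt → ℝ) : Prop :=
  ∃ Tlim : Vec₂ dp dt → ℝ, ContinuousOn Tlim (link τ '' Θo) ∧
    ToZeroInProb P (fun (n : ℕ) ω => ⨆ δ ∈ link τ '' Θo, ENNReal.ofReal |T n ω δ - Tlim δ|) ∧
    ∀ U ∈ 𝓝 (link τ θs), ∃ ε : ℝ, 0 < ε ∧
      ∀ δ ∈ link τ '' Θo, δ ∉ U → Tlim (link τ θs) + ε ≤ Tlim δ

/-- The remainder of the second-order expansion of `f` at `δ₀`. -/
def remainder (f : Vec₂ dp dt → ℝ) (δ₀ δ : Vec₂ dp dt) : ℝ :=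
  f δ - f δ₀ - (gradient f δ₀).ofLp ⬝ᵥ (δ - δ₀).ofLp -
    (1 / 2) * quad (hessian f δ₀) (δ - δ₀).ofLp

/-- Quadratic expansion of `T_n` around `δ_n = δ(θ_n)`. -/
def QuadraticExpansion (P : ∀ n, Measure (Ω n)) (Θo : Set (Vec dp × Vec db))
    (τ : Vec dp × Vec db → Vec dt) (θ : ℕ → Vec dp × Vec db)
    (T : ∀ n, Ω n → Vec₂ dp dt → ℝ) : Prop :=
  ∀ η : ℕ → ℝ, (∀ n, 0 < η n) → Tendsto η atTop (𝓝 0) →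
    ToZeroInProb P (fun (n : ℕ) ω => ⨆ δ ∈ {δ ∈ link τ '' Θo | ‖δ - link τ (θ n)‖ ≤ η n},
      ENNReal.ofReal (|n * remainder (T n ω) (link τ (θ n)) δ| /
        (1 + √(n : ℝ) * ‖δ - link τ (θ n)‖) ^ 2))

/-- `√n ∂T_n(δ_n) →_d Y ~ N(0, V)` and `∂∂T_n(δ_n) →_p H`, with `V` and `H` symmetric and positive
definite. -/
def ReducedFormLimits (P : ∀ n, Measure (Ω n)) [∀ n, IsProbabilityMeasure (P n)]
    (τ : Vec dp × Vec db → Vec dt) (θ : ℕ → Vec dp × Vec db)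
    (T : ∀ n, Ω n → Vec₂ dp dt → ℝ) {Ω' : Type*} [MeasurableSpace Ω'] (P' : Measure Ω')
    [IsProbabilityMeasure P'] (Y : Ω' → Vec₂ dp dt)
    (V H : Matrix (Fin dp ⊕ Fin dt) (Fin dp ⊕ Fin dt) ℝ) : Prop :=
  V.PosDef ∧ HasLaw Y (multivariateGaussian 0 V) P' ∧
  TendstoInDistribution (fun (n : ℕ) ω => √(n : ℝ) • gradient (T n ω) (link τ (θ n))) atTop Y P P' ∧
  H.PosDef ∧
  ∀ i j, ToZeroInProb P
    (fun n ω => ENNReal.ofReal |hessian (T n ω) (link τ (θ n)) i j - H i j|)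

end Objective

/-! ### The limit random variables, as functions of the value `y` of `Y` -/

/-- `D = [I, 0; ∂_π τ(θ_*), C]`. -/
def matD (τ : Vec dp × Vec db → Vec dt) (θs : Vec dp × Vec db) (C : Matrix (Fin dt) (Fin db) ℝ) :
    Matrix (Fin dp ⊕ Fin dt) (Fin dp ⊕ Fin db) ℝ :=
  Matrix.fromBlocks 1 0 (dτπ τ θs) C

/-- `D_1(θ) = [I; ∂_π τ(θ)]`. -/
def matD₁ (τ : Vec dp × Vec db → Vec dt) (θ : Vec dp × Vec db) :
    Matrix (Fin dp ⊕ Fin dt) (Fin dp) ℝ :=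
  Matrix.fromRows 1 (dτπ τ θ)

/-- `D' H D`. -/
def matJ {ι κ : Type*} [Fintype ι] (H : Matrix ι ι ℝ) (D : Matrix ι κ ℝ) : Matrix κ κ ℝ :=
  Dᵀ * H * D

/-- `-(D' H D)⁻¹ D' y`. -/
def vecZ {ι κ : Type*} [Fintype ι] [Fintype κ] [DecidableEq κ] (H : Matrix ι ι ℝ)
    (D : Matrix ι κ ℝ) (y : ι → ℝ) : κ → ℝ :=
  -((matJ H D)⁻¹ *ᵥ (Dᵀ *ᵥ y))

/-- `QLR^S = inf_{ψ ∈ Ψ^r} (Z - ψ)'J(Z - ψ) - inf_{ψ ∈ Ψ} (Z - ψ)'J(Z - ψ)`. -/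
def qlrS (H : Matrix (Fin dp ⊕ Fin dt) (Fin dp ⊕ Fin dt) ℝ)
    (D : Matrix (Fin dp ⊕ Fin dt) (Fin dp ⊕ Fin db) ℝ) (Ψ Ψr : Set (Vec₂ dp db))
    (y : Vec₂ dp dt) : ℝ :=
  sInf ((fun ψ : Vec₂ dp db => quad (matJ H D) (vecZ H D y.ofLp - ψ.ofLp)) '' Ψr) -
    sInf ((fun ψ : Vec₂ dp db => quad (matJ H D) (vecZ H D y.ofLp - ψ.ofLp)) '' Ψ)

/-- `J_11(β) = D_1(π_*, β)' H D_1(π_*, β)`. -/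
def matJ₁₁ (τ : Vec dp × Vec db → Vec dt) (πs : Vec dp)
    (H : Matrix (Fin dp ⊕ Fin dt) (Fin dp ⊕ Fin dt) ℝ) (β : Vec db) :
    Matrix (Fin dp) (Fin dp) ℝ :=
  matJ H (matD₁ τ (πs, β))

/-- `g(β) = (0, c(β))`. -/
def vecG (c : Vec db → Vec dt) (β : Vec db) : Fin dp ⊕ Fin dt → ℝ :=
  Sum.elim 0 (c β).ofLp

/-- `Z_1(β) = -J_11(β)⁻¹ D_1(π_*, β)' (Y + H g(β))`. -/
def vecZ₁ (τ : Vec dp × Vec db → Vec dt) (πs : Vec dp)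
    (H : Matrix (Fin dp ⊕ Fin dt) (Fin dp ⊕ Fin dt) ℝ) (c : Vec db → Vec dt) (y : Vec₂ dp dt)
    (β : Vec db) : Fin dp → ℝ :=
  vecZ H (matD₁ τ (πs, β)) (y.ofLp + H *ᵥ vecG c β)

/-- The concentrated limit objective
`q̃^W(β) = g(β)'H g(β)/2 + Y'g(β) - Z_1(β)'J_11(β)Z_1(β)/2`. -/
def qW (τ : Vec dp × Vec db → Vec dt) (πs : Vec dp)
    (H : Matrix (Fin dp ⊕ Fin dt) (Fin dp ⊕ Fin dt) ℝ) (c : Vec db → Vec dt) (y : Vec₂ dp dt)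
    (β : Vec db) : ℝ :=
  quad H (vecG c β) / 2 + y.ofLp ⬝ᵥ vecG c β -
    quad (matJ₁₁ τ πs H β) (vecZ₁ τ πs H c y β) / 2

/-- `q̃^{W,r}(β) = q̃^W(β) + Z_1(β)'R_1'(R_1 J_11(β)⁻¹ R_1')⁻¹ R_1 Z_1(β)/2`. -/
def qWr (τ : Vec dp × Vec db → Vec dt) (πs : Vec dp)
    (H : Matrix (Fin dp ⊕ Fin dt) (Fin dp ⊕ Fin dt) ℝ) (c : Vec db → Vec dt)
    (R₁ : Matrix (Fin k₁) (Fin dp) ℝ) (y : Vec₂ dp dt) (β : Vec db) : ℝ :=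
  qW τ πs H c y β +
    quad (R₁ * (matJ₁₁ τ πs H β)⁻¹ * R₁ᵀ)⁻¹ (R₁ *ᵥ vecZ₁ τ πs H c y β) / 2

/-- `QLR^{W1}`. -/
def qlrW1 (Θ : Set (Vec dp × Vec db)) (τ : Vec dp × Vec db → Vec dt) (θs : Vec dp × Vec db)
    (H : Matrix (Fin dp ⊕ Fin dt) (Fin dp ⊕ Fin dt) ℝ) (c : Vec db → Vec dt)
    (Ψr : Set (Vec₂ dp db)) (y : Vec₂ dp dt) : ℝ :=
  sInf ((fun ψ : Vec₂ dp db => quad (matJ₁₁ τ θs.1 H θs.2)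
      (vecZ₁ τ θs.1 H c y θs.2 - fun i => ψ (Sum.inl i))) '' Ψr) -
    quad (matJ₁₁ τ θs.1 H θs.2) (vecZ₁ τ θs.1 H c y θs.2) -
    sInf ((fun β => 2 * qW τ θs.1 H c y β) '' crossSec Θ {θs.1})

/-- `QLR^{W2}`. -/
def qlrW2 (Θ : Set (Vec dp × Vec db)) (τ : Vec dp × Vec db → Vec dt) (πs : Vec dp)
    (H : Matrix (Fin dp ⊕ Fin dt) (Fin dp ⊕ Fin dt) ℝ) (c : Vec db → Vec dt)
    (r₁ : Vec dp → Vec k₁) (r₂ : Vec db → Vec k₂) (y : Vec₂ dp dt) : ℝ :=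
  sInf ((fun β => 2 * qWr τ πs H c (jacobian r₁ πs) y β) '' crossSecR Θ r₂ πs) -
    sInf ((fun β => 2 * qW τ πs H c y β) '' crossSec Θ {πs})

end Model

end QLRLimit

end

open QLRLimit

/-!
Near the truth the objective depends on the parameters through `δ(θ)` only and is quadratic there:
with `h = √n (δ(θ) - δ_n)` and `Y_n = √n ∂T_n(δ_n)`, twice the rescaled objective is
`2 Y_n'h + h'Hh` up to an error that is small relative to `(1 + ‖h‖)²` (`exists_near_approx`), while
parameters with `δ(θ)` away from `δ_n` do not compete (`tendsto_measure_far`). As `H` is positive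
definite, only bounded `h` matter, so on the events `‖Y_n‖ ≤ K` the QLR statistic is within `o_p(1)`
of the difference of the infima of `2 Y_n'h + h'Hh` over two nonrandom sets, the images
`{√n (δ(θ) - δ_n)}` of the restricted and the unrestricted parameter space
(`abs_sInf_sub_infObj_le`, `tendsto_measure_qlr_approx`).

The rest concerns those sets. If they converge in the sense of Painlevé and Kuratowski, the infima,
as functions of `Y_n`, converge continuously to the infima over the limit sets (`tendsto_infObj`),
and the extended continuous mapping theorem gives the limit distribution
(`tendstoInDistribution_qlr`). In particular all kinds of identification are treated alike, and
differ only in the limit sets: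

* for strong and semi-strong sequences the limit of the sets is the image under the matrix `D` of
  the limit `Ψ` of the local parameter spaces (`IdentifiedSeq.pkLimit_linkLocal`);
* for weak sequences `π` is localized but `β` is not, and the limit consists of the points
  `D_1(π_*, β) p + g(β)`, where `p` is free and `β ∈ B_*` for the full parameter space
  (`pkLimit_weakLocal`), and, under the null hypothesis, `R₁ p = 0` and `β ∈ B^r_*`
  (`pkLimit_weakLocal_restricted`), or `(p, 0) ∈ Ψ^r` and `β = β_*`
  (`pkLimit_weakLocal_of_nullPinsBeta`).

Completing the square then yields the stated limits. Clusters of local parameters are handled with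
ultrafilters instead of subsequences: along an ultrafilter every bounded family converges.
-/

namespace QLRLimit

/-! ### Quadratic objectives over converging sets -/

/-- Painlevé–Kuratowski convergence of the sets `A n` to `B`: every cluster point of points of the
`A n` lies in `B`, and every point of `B` is a limit of points of the `A n`. For closed limits in
finite dimension this is what `KuratowskiTendsto` says. -/
structure PKLimit {X : Type*} [TopologicalSpace X] (A : ℕ → Set X) (B : Set X) : Prop where
  upper : ∀ x, (∃ᶠ p in (atTop : Filter ℕ) ×ˢ 𝓝 x, p.2 ∈ A p.1) → x ∈ B
  lower : ∀ x ∈ B, ∃ u : ℕ → X, (∀ᶠ n in atTop, u n ∈ A n) ∧ Tendsto u atTop (𝓝 x)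

theorem PKLimit.mem_of_tendsto {X α : Type*} [TopologicalSpace X] {A : ℕ → Set X} {B : Set X}
    (h : PKLimit A B) {l : Filter α} [l.NeBot] {ν : α → ℕ} {u : α → X} {x : X}
    (hν : Tendsto ν l atTop) (hu : Tendsto u l (𝓝 x)) (hA : ∀ᶠ a in l, u a ∈ A (ν a)) : x ∈ B := by
  refine h.upper x fun hc => ?_
  obtain ⟨a, ha, hb⟩ := (((hν.prodMk hu).eventually hc).and hA).exists
  exact ha hb

/-- The clause `PKLimit.upper` may be tested along ultrafilters on `ℕ × X`. -/
theorem exists_ultrafilter_of_frequently {X : Type*} [TopologicalSpace X] {A : ℕ → Set X} {x : X}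
    (h : ∃ᶠ p in (atTop : Filter ℕ) ×ˢ 𝓝 x, p.2 ∈ A p.1) :
    ∃ U : Ultrafilter (ℕ × X), Tendsto Prod.fst (U : Filter (ℕ × X)) atTop ∧
      Tendsto Prod.snd (U : Filter (ℕ × X)) (𝓝 x) ∧ ∀ᶠ p in (U : Filter (ℕ × X)), p.2 ∈ A p.1 := by
  have hne : ((atTop ×ˢ 𝓝 x) ⊓ 𝓟 {p : ℕ × X | p.2 ∈ A p.1}).NeBot :=
    frequently_mem_iff_neBot.1 h
  obtain ⟨U, hU⟩ := Ultrafilter.exists_le ((atTop ×ˢ 𝓝 x) ⊓ 𝓟 {p : ℕ × X | p.2 ∈ A p.1})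
  have h1 := hU.trans inf_le_left
  exact ⟨U, tendsto_fst.mono_left h1, tendsto_snd.mono_left h1,
    le_principal_iff.1 (hU.trans inf_le_right)⟩

/-- Along an ultrafilter every family in a compact set converges. -/
theorem exists_tendsto_of_isCompact {X α : Type*} [TopologicalSpace X] {K : Set X}
    (hK : IsCompact K) (U : Ultrafilter α) {f : α → X} (hf : ∀ᶠ a in (U : Filter α), f a ∈ K) :
    ∃ x ∈ K, Tendsto f U (𝓝 x) :=
  hK.ultrafilter_le_nhds (U.map f) (le_principal_iff.2 hf)

theorem exists_tendsto_of_norm_le {X α : Type*} [NormedAddCommGroup X] [ProperSpace X]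
    (U : Ultrafilter α) {f : α → X} {R : ℝ} (hf : ∀ᶠ a in (U : Filter α), ‖f a‖ ≤ R) :
    ∃ x, Tendsto f U (𝓝 x) := by
  obtain ⟨x, -, hx⟩ := exists_tendsto_of_isCompact (isCompact_closedBall (0 : X) R) U (f := f)
    (hf.mono fun a ha => by simpa using ha)
  exact ⟨x, hx⟩

section Quadratic

variable {ι : Type*} [Fintype ι]

theorem continuous_quad (A : Matrix ι ι ℝ) :
    Continuous fun v : EuclideanSpace ℝ ι => quad A v.ofLp := by
  unfold quad; fun_prop

theorem quad_smul (A : Matrix ι ι ℝ) (r : ℝ) (v : ι → ℝ) : quad A (r • v) = r ^ 2 * quad A v := by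
  simp only [quad, Matrix.mulVec_smul, smul_dotProduct, dotProduct_smul, smul_eq_mul]; ring

theorem abs_dotProduct_le (x y : EuclideanSpace ℝ ι) : |x.ofLp ⬝ᵥ y.ofLp| ≤ ‖x‖ * ‖y‖ := by
  have := abs_real_inner_le_norm y x
  rw [EuclideanSpace.inner_eq_star_dotProduct] at this
  simpa [mul_comm] using this

/-- A positive definite quadratic form is bounded below by a multiple of the squared norm. -/
theorem exists_quad_lower {H : Matrix ι ι ℝ} (hH : H.PosDef) :
    ∃ r : ℝ, 0 < r ∧ ∀ v : EuclideanSpace ℝ ι, r * ‖v‖ ^ 2 ≤ quad H v.ofLp := by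
  have hpos : ∀ v : EuclideanSpace ℝ ι, v ≠ 0 → 0 < quad H v.ofLp := fun v hv => by
    simpa [quad] using hH.dotProduct_mulVec_pos (x := v.ofLp) (by simpa using hv)
  obtain ⟨r, hr, h⟩ : ∃ r : ℝ, 0 < r ∧
      ∀ v ∈ Metric.sphere (0 : EuclideanSpace ℝ ι) 1, r ≤ quad H v.ofLp := by
    rcases (Metric.sphere (0 : EuclideanSpace ℝ ι) 1).eq_empty_or_nonempty with he | hne
    · exact ⟨1, one_pos, by simp [he]⟩
    · obtain ⟨v, hv, hmin⟩ := (isCompact_sphere _ _).exists_isMinOn hne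
        (continuous_quad H).continuousOn
      exact ⟨_, hpos v (by rintro rfl; simp at hv), fun w hw => hmin hw⟩
  refine ⟨r, hr, fun v => ?_⟩
  rcases eq_or_ne v 0 with rfl | hv
  · simp [quad]
  · have hn : ‖v‖ ≠ 0 := norm_ne_zero_iff.2 hv
    have h1 := h (‖v‖⁻¹ • v) (by simp [norm_smul, hn])
    rw [WithLp.ofLp_smul, quad_smul, inv_pow, inv_mul_eq_div, le_div_iff₀ (by positivity)] at h1
    exact h1

/-- Twice the quadratic approximation `y'h + h'Hh/2` of the localized objective. -/
noncomputable def qobj (H : Matrix ι ι ℝ) (y h : EuclideanSpace ℝ ι) : ℝ :=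
  2 * (y.ofLp ⬝ᵥ h.ofLp) + quad H h.ofLp

/-- The infimum of the quadratic objective over the set `A` of local parameters. -/
noncomputable def infObj (H : Matrix ι ι ℝ) (A : Set (EuclideanSpace ℝ ι))
    (y : EuclideanSpace ℝ ι) : ℝ :=
  sInf (qobj H y '' A)

theorem continuous_qobj (H : Matrix ι ι ℝ) :
    Continuous fun p : EuclideanSpace ℝ ι × EuclideanSpace ℝ ι => qobj H p.1 p.2 := by
  unfold qobj quad; fun_prop

@[simp] theorem qobj_zero (H : Matrix ι ι ℝ) (y : EuclideanSpace ℝ ι) : qobj H y 0 = 0 := by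
  simp [qobj, quad]

theorem le_qobj {H : Matrix ι ι ℝ} {r : ℝ}
    (hr : ∀ v : EuclideanSpace ℝ ι, r * ‖v‖ ^ 2 ≤ quad H v.ofLp) (y h : EuclideanSpace ℝ ι) :
    r * ‖h‖ ^ 2 - 2 * (‖y‖ * ‖h‖) ≤ qobj H y h := by
  have h1 := (abs_le.1 (abs_dotProduct_le y h)).1
  have h2 := hr h
  unfold qobj; linarith

theorem bddBelow_qobj {H : Matrix ι ι ℝ} (hH : H.PosDef) (y : EuclideanSpace ℝ ι)
    (A : Set (EuclideanSpace ℝ ι)) : BddBelow (qobj H y '' A) := by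
  obtain ⟨r, hr, h⟩ := exists_quad_lower hH
  refine ⟨-(‖y‖ ^ 2 / r), ?_⟩
  rintro _ ⟨v, -, rfl⟩
  refine le_trans ?_ (le_qobj h y v)
  have : r * ‖v‖ ^ 2 - 2 * (‖y‖ * ‖v‖) + ‖y‖ ^ 2 / r = (r * ‖v‖ - ‖y‖) ^ 2 / r := by
    field_simp; ring
  have h2 : 0 ≤ (r * ‖v‖ - ‖y‖) ^ 2 / r := by positivity
  linarith

theorem infObj_le {H : Matrix ι ι ℝ} (hH : H.PosDef) (y : EuclideanSpace ℝ ι)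
    {A : Set (EuclideanSpace ℝ ι)} {h : EuclideanSpace ℝ ι} (hA : h ∈ A) :
    infObj H A y ≤ qobj H y h :=
  csInf_le (bddBelow_qobj hH y A) (mem_image_of_mem _ hA)

theorem infObj_nonpos {H : Matrix ι ι ℝ} (hH : H.PosDef) (y : EuclideanSpace ℝ ι)
    {A : Set (EuclideanSpace ℝ ι)} (hA : 0 ∈ A) : infObj H A y ≤ 0 :=
  (infObj_le hH y hA).trans_eq (qobj_zero H y)

theorem norm_le_of_qobj_le {H : Matrix ι ι ℝ} {r : ℝ} (hr0 : 0 < r)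
    (hr : ∀ v : EuclideanSpace ℝ ι, r * ‖v‖ ^ 2 ≤ quad H v.ofLp) {y h : EuclideanSpace ℝ ι} {K : ℝ}
    (hy : ‖y‖ ≤ K) (hq : qobj H y h ≤ 1) : ‖h‖ ≤ (2 * K + 1) / r + 1 := by
  have hK : 0 ≤ K := (norm_nonneg y).trans hy
  have h1 := le_qobj hr y h
  have h5 : ‖y‖ * ‖h‖ ≤ K * ‖h‖ := by gcongr
  by_contra! hc
  have h6 : 1 < ‖h‖ := lt_of_le_of_lt (le_add_of_nonneg_left (by positivity)) hc
  have h7 : (2 * K + 1) / r < ‖h‖ := by linarith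
  rw [div_lt_iff₀ hr0] at h7
  nlinarith

theorem tendsto_qobj {α : Type*} {l : Filter α} {f g : α → EuclideanSpace ℝ ι}
    {y h : EuclideanSpace ℝ ι} (hf : Tendsto f l (𝓝 y)) (hg : Tendsto g l (𝓝 h))
    (H : Matrix ι ι ℝ) : Tendsto (fun a => qobj H (f a) (g a)) l (𝓝 (qobj H y h)) := by
  have h1 : Tendsto (fun a => (f a, g a)) l (𝓝 (y, h)) := hf.prodMk_nhds hg
  have h2 := (continuous_qobj H).tendsto (y, h)
  simpa only [Function.comp_def] using h2.comp h1

/-- Near-minimizers of the quadratic objective. -/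
theorem exists_qobj_lt (H : Matrix ι ι ℝ) {A : Set (EuclideanSpace ℝ ι)} (h0 : 0 ∈ A)
    (y : EuclideanSpace ℝ ι) {ε : ℝ} (hε : 0 < ε) : ∃ h ∈ A, qobj H y h < infObj H A y + ε := by
  obtain ⟨_, ⟨h, hh, rfl⟩, hlt⟩ := exists_lt_of_csInf_lt (s := qobj H y '' A)
    ⟨_, mem_image_of_mem _ h0⟩ (lt_add_of_pos_right _ hε)
  exact ⟨h, hh, hlt⟩

/-- The minimal value of a coercive quadratic objective depends continuously on the set and on the
linear coefficient: near-minimizers stay bounded, hence cluster at points of the limit set. -/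
theorem tendsto_infObj_ultrafilter {H : Matrix ι ι ℝ} (hH : H.PosDef)
    {A : ℕ → Set (EuclideanSpace ℝ ι)} {B : Set (EuclideanSpace ℝ ι)} (hAB : PKLimit A B)
    (h0 : ∀ n, 0 ∈ A n) {α : Type*} (U : Ultrafilter α) {ν : α → ℕ} {f : α → EuclideanSpace ℝ ι}
    {y : EuclideanSpace ℝ ι} (hν : Tendsto ν U atTop) (hf : Tendsto f U (𝓝 y)) :
    Tendsto (fun a => infObj H (A (ν a)) (f a)) U (𝓝 (infObj H B y)) := by
  have hpos : ∀ n : ℕ, (0 : ℝ) < 1 / ((n : ℝ) + 1) := fun n => by positivity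
  have hε : Tendsto (fun a => 1 / ((ν a : ℝ) + 1)) U (𝓝 0) :=
    tendsto_one_div_add_atTop_nhds_zero_nat.comp hν
  choose h hA hlt using fun a => exists_qobj_lt H (h0 (ν a)) (f a) (hpos (ν a))
  obtain ⟨r, hr, hquad⟩ := exists_quad_lower hH
  have hbd : ∀ᶠ a in (U : Filter α), ‖h a‖ ≤ (2 * (‖y‖ + 1) + 1) / r + 1 := by
    filter_upwards [hf.norm.eventually (eventually_le_nhds (lt_add_one ‖y‖)),
      hε.eventually (eventually_le_nhds one_pos)] with a ha h3
    have h2 := infObj_nonpos hH (f a) (h0 (ν a))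
    exact norm_le_of_qobj_le hr hquad ha (by linarith [hlt a])
  obtain ⟨x, hx⟩ := exists_tendsto_of_norm_le U hbd
  have hxB : x ∈ B := hAB.mem_of_tendsto hν hx (Eventually.of_forall hA)
  have hq : Tendsto (fun a => qobj H (f a) (h a)) U (𝓝 (qobj H y x)) := tendsto_qobj hf hx H
  have hq' : Tendsto (fun a => qobj H (f a) (h a) - 1 / ((ν a : ℝ) + 1)) U (𝓝 (qobj H y x)) := by
    have := hq.sub hε
    rwa [sub_zero] at this
  have hlim : Tendsto (fun a => infObj H (A (ν a)) (f a)) U (𝓝 (qobj H y x)) :=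
    tendsto_of_tendsto_of_tendsto_of_le_of_le hq' hq (fun a => sub_le_iff_le_add.2 (hlt a).le)
      (fun a => infObj_le hH (f a) (hA a))
  have heq : infObj H B y = qobj H y x := by
    refine le_antisymm (infObj_le hH y hxB) (le_csInf ⟨_, mem_image_of_mem _ hxB⟩ ?_)
    rintro _ ⟨b, hb, rfl⟩
    obtain ⟨u, huA, hu⟩ := hAB.lower b hb
    refine le_of_tendsto_of_tendsto hlim (tendsto_qobj hf (hu.comp hν) H) ?_
    filter_upwards [hν.eventually huA] with a ha
    exact infObj_le hH (f a) ha
  rwa [heq]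

theorem tendsto_infObj {H : Matrix ι ι ℝ} (hH : H.PosDef) {A : ℕ → Set (EuclideanSpace ℝ ι)}
    {B : Set (EuclideanSpace ℝ ι)} (hAB : PKLimit A B) (h0 : ∀ n, 0 ∈ A n)
    (y : EuclideanSpace ℝ ι) :
    Tendsto (fun p : ℕ × EuclideanSpace ℝ ι => infObj H (A p.1) p.2) (atTop ×ˢ 𝓝 y)
      (𝓝 (infObj H B y)) := by
  rw [tendsto_iff_ultrafilter]
  exact fun U hU => tendsto_infObj_ultrafilter hH hAB h0 U (tendsto_fst.mono_left hU)
    (tendsto_snd.mono_left hU)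

end Quadratic

/-! ### Set limits and distances -/

theorem exists_tendsto_of_infEDist {X : Type*} [PseudoEMetricSpace X] {A : ℕ → Set X} {x : X}
    (h : Tendsto (fun n => Metric.infEDist x (A n)) atTop (𝓝 0)) :
    ∃ u : ℕ → X, (∀ᶠ n in atTop, u n ∈ A n) ∧ Tendsto u atTop (𝓝 x) := by
  have hex : ∀ n : ℕ, ∃ z, Metric.infEDist x (A n) ≠ ⊤ →
      z ∈ A n ∧ edist x z < Metric.infEDist x (A n) + ((n : ℝ≥0∞) + 1)⁻¹ := fun n => by
    by_cases hn : Metric.infEDist x (A n) = ⊤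
    · exact ⟨x, fun h => absurd hn h⟩
    · obtain ⟨z, hz, hlt⟩ := Metric.infEDist_lt_iff.1
        (ENNReal.lt_add_right hn (b := ((n : ℝ≥0∞) + 1)⁻¹) (by simp))
      exact ⟨z, fun _ => ⟨hz, hlt⟩⟩
  choose u hu using hex
  have hfin : ∀ᶠ n in atTop, Metric.infEDist x (A n) ≠ ⊤ :=
    (h.eventually (eventually_lt_nhds ENNReal.zero_lt_top)).mono fun n hn => hn.ne
  have hlim : Tendsto (fun n : ℕ => Metric.infEDist x (A n) + ((n : ℝ≥0∞) + 1)⁻¹) atTop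
      (𝓝 0) := by
    have h1 : Tendsto (fun n : ℕ => ((n : ℝ≥0∞) + 1)⁻¹) atTop (𝓝 0) := by
      have := (tendsto_add_atTop_iff_nat 1).2 ENNReal.tendsto_inv_nat_nhds_zero
      simpa using this
    simpa using h.add h1
  refine ⟨u, hfin.mono fun n hn => (hu n hn).1, ?_⟩
  rw [tendsto_iff_edist_tendsto_0]
  refine tendsto_of_tendsto_of_tendsto_of_le_of_le' tendsto_const_nhds hlim
    (Eventually.of_forall fun _ => zero_le) (hfin.mono fun n hn => ?_)
  rw [edist_comm]
  exact (hu n hn).2.le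

theorem KuratowskiTendsto.pkLimit {X : Type*} [MetricSpace X] [ProperSpace X] {A : ℕ → Set X}
    {B : Set X} (h : KuratowskiTendsto A B) (hB : IsClosed B) :
    PKLimit A B where
  upper x hx := by
    have hcl : x ∈ closure B := by
      rw [Metric.mem_closure_iff_infEDist_zero]
      refine le_antisymm (ENNReal.le_of_forall_pos_le_add fun ε hε _ => ?_) zero_le
      have hε2 : (0 : ℝ≥0∞) < ((ε / 2 : NNReal) : ℝ≥0∞) := by
        rw [ENNReal.coe_pos]; exact half_pos hε
      have h1 := (h (Metric.closedBall x 1) (isCompact_closedBall x 1)).eventually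
        (eventually_lt_nhds hε2)
      have h2 : ∀ᶠ p in (atTop : Filter ℕ) ×ˢ 𝓝 x,
          max (dirDist (A p.1 ∩ Metric.closedBall x 1) B)
              (dirDist (B ∩ Metric.closedBall x 1) (A p.1)) < ((ε / 2 : NNReal) : ℝ≥0∞) ∧
            (p.2 ∈ Metric.closedBall x 1 ∧ p.2 ∈ Metric.eball x ((ε / 2 : NNReal) : ℝ≥0∞)) :=
        h1.prod_mk ((eventually_mem_set.2 (Metric.closedBall_mem_nhds x one_pos)).and
          (Metric.eball_mem_nhds x hε2))
      obtain ⟨⟨n, z⟩, hz, hlt, hz1, hz2⟩ := (hx.and_eventually h2).exists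
      have h3 : Metric.infEDist z B ≤ ((ε / 2 : NNReal) : ℝ≥0∞) :=
        (le_iSup₂ (f := fun a (_ : a ∈ A n ∩ Metric.closedBall x 1) => Metric.infEDist a B) z
          ⟨hz, hz1⟩).trans ((le_max_left _ _).trans hlt.le)
      calc Metric.infEDist x B ≤ Metric.infEDist z B + edist x z :=
            Metric.infEDist_le_infEDist_add_edist
        _ ≤ ((ε / 2 : NNReal) : ℝ≥0∞) + ((ε / 2 : NNReal) : ℝ≥0∞) := by
            refine add_le_add h3 ?_
            rw [edist_comm]; exact (Metric.mem_eball.1 hz2).le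
        _ = 0 + ε := by rw [← ENNReal.coe_add, add_halves, zero_add]
    rwa [hB.closure_eq] at hcl
  lower x hx := by
    have h1 : Tendsto (fun n => Metric.infEDist x (A n)) atTop (𝓝 0) := by
      refine tendsto_of_tendsto_of_tendsto_of_le_of_le tendsto_const_nhds
        (h {x} isCompact_singleton) (fun _ => zero_le) (fun n => ?_)
      exact (le_iSup₂ (f := fun a (_ : a ∈ B ∩ {x}) => Metric.infEDist a (A n)) x
        ⟨hx, rfl⟩).trans (le_max_right _ _)
    exact exists_tendsto_of_infEDist h1

/-! ### Localization of the infimum of the objective -/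

section Localization

variable {dp db dt : ℕ}

/-- The reduced-form local parameters `√n (δ(t) - δ(t₀))`, `t ∈ S`. -/
def linkLocal (n : ℕ) (τ : Vec dp × Vec db → Vec dt) (t₀ : Vec dp × Vec db)
    (S : Set (Vec dp × Vec db)) : Set (Vec₂ dp dt) :=
  (fun t => √(n : ℝ) • (link τ t - link τ t₀)) '' S

theorem zero_mem_linkLocal (n : ℕ) (τ : Vec dp × Vec db → Vec dt) {t₀ : Vec dp × Vec db}
    {S : Set (Vec dp × Vec db)} (h : t₀ ∈ S) : 0 ∈ linkLocal n τ t₀ S :=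
  ⟨t₀, h, by simp⟩

/-- Suppose that `q` is at least `q t₀` on the part of `S` where `δ` is farther than `η` from
`δ(t₀)`, and that on the other part the rescaled objective is within `ε (1 + ‖h‖)²` of a quadratic
one. Then so are the infima, up to a factor that depends only on the coercivity constant `r` of the
quadratic form and the bound `K` for the linear coefficient, because local parameters of norm
above `1 + 4 K / r` cannot beat `h = 0`. -/
theorem abs_sInf_sub_infObj_le {n : ℕ} (hn : 0 < n) {τ : Vec dp × Vec db → Vec dt}
    {t₀ : Vec dp × Vec db} {S : Set (Vec dp × Vec db)} (ht₀ : t₀ ∈ S)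
    {H : Matrix (Fin dp ⊕ Fin dt) (Fin dp ⊕ Fin dt) ℝ} (hH : H.PosDef)
    {q : Vec dp × Vec db → ℝ} {c r ε η K : ℝ} {y : Vec₂ dp dt} (hr0 : 0 < r)
    (hr : ∀ v : Vec₂ dp dt, r * ‖v‖ ^ 2 ≤ quad H v.ofLp) (hy : ‖y‖ ≤ K) (hη : 0 < η)
    (hε0 : 0 < ε) (hε : 8 * ε ≤ r) (hρ : 1 + 4 * K / r ≤ √(n : ℝ) * η)
    (hfar : ∀ t ∈ S, η < ‖link τ t - link τ t₀‖ → q t₀ ≤ q t)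
    (hnear : ∀ t ∈ S, ‖link τ t - link τ t₀‖ ≤ η →
      |2 * (n * (q t - c)) - qobj H y (√(n : ℝ) • (link τ t - link τ t₀))| ≤
        ε * (1 + √(n : ℝ) * ‖link τ t - link τ t₀‖) ^ 2) :
    |2 * (n * (sInf (q '' S) - c)) - infObj H (linkLocal n τ t₀ S) y| ≤
      ε * (1 + (1 + 4 * K / r)) ^ 2 := by
  have hn' : (0 : ℝ) < n := by exact_mod_cast hn
  have hsq : (0 : ℝ) < √(n : ℝ) := Real.sqrt_pos.2 hn'
  have hK : 0 ≤ K := (norm_nonneg y).trans hy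
  set ρ := 1 + 4 * K / r with hρdef
  have hρ1 : 1 ≤ ρ := le_add_of_nonneg_right (by positivity)
  set F := infObj H (linkLocal n τ t₀ S) y with hF
  have hF0 : F ≤ 0 := infObj_nonpos hH y (zero_mem_linkLocal n τ ht₀)
  have hE : ε ≤ ε * (1 + ρ) ^ 2 := le_mul_of_one_le_right hε0.le (by nlinarith)
  have h0 : |2 * (n * (q t₀ - c))| ≤ ε := by
    have := hnear t₀ ht₀ (by simpa using hη.le)
    simpa using this
  -- Beyond `ρ` the quadratic objective dominates the approximation error.
  have hbig : ∀ h : Vec₂ dp dt, ρ < ‖h‖ → ε * (1 + ‖h‖) ^ 2 ≤ qobj H y h := fun h hh => by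
    have h1 := le_qobj hr y h
    have h2 : ‖y‖ * ‖h‖ ≤ K * ‖h‖ := by gcongr
    have h3 : 4 * K / r < ‖h‖ := by linarith
    rw [div_lt_iff₀ hr0] at h3
    have h4 : 1 < ‖h‖ := by linarith
    have h5 : (1 + ‖h‖) ^ 2 ≤ 4 * ‖h‖ ^ 2 := by nlinarith
    have h6 : ε * (1 + ‖h‖) ^ 2 ≤ ε * (4 * ‖h‖ ^ 2) := by gcongr
    have h7 : 8 * ε * ‖h‖ ^ 2 ≤ r * ‖h‖ ^ 2 := by gcongr
    have h8 : 4 * K * ‖h‖ ≤ ‖h‖ * r * ‖h‖ := by gcongr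
    nlinarith
  have hlow : ∀ t ∈ S, F - ε * (1 + ρ) ^ 2 ≤ 2 * (n * (q t - c)) := fun t ht => by
    rcases lt_or_ge η ‖link τ t - link τ t₀‖ with hf | hf
    · have h1 : 2 * (n * (q t₀ - c)) ≤ 2 * (n * (q t - c)) := by
        have := hfar t ht hf; gcongr
      have h2 := (abs_le.1 h0).1
      linarith
    · have h1 := (abs_le.1 (hnear t ht hf)).1
      have hnorm : ‖√(n : ℝ) • (link τ t - link τ t₀)‖ = √(n : ℝ) * ‖link τ t - link τ t₀‖ := by
        rw [norm_smul, Real.norm_of_nonneg hsq.le]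
      rcases lt_or_ge ρ ‖√(n : ℝ) • (link τ t - link τ t₀)‖ with hb | hb
      · have h2 := hbig _ hb
        rw [hnorm] at h2
        linarith
      · have h2 : F ≤ qobj H y (√(n : ℝ) • (link τ t - link τ t₀)) :=
          infObj_le hH y (mem_image_of_mem _ ht)
        have h3 : ε * (1 + √(n : ℝ) * ‖link τ t - link τ t₀‖) ^ 2 ≤ ε * (1 + ρ) ^ 2 := by
          rw [hnorm] at hb; gcongr
        linarith
  have hbdd : BddBelow (q '' S) := by
    refine ⟨(F - ε * (1 + ρ) ^ 2) / (2 * n) + c, ?_⟩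
    rintro _ ⟨t, ht, rfl⟩
    rw [← le_sub_iff_add_le, div_le_iff₀ (by positivity)]
    linarith [hlow t ht]
  have hinf : ∀ t ∈ S, 2 * (n * (sInf (q '' S) - c)) ≤ 2 * (n * (q t - c)) := fun t ht => by
    have := csInf_le hbdd (mem_image_of_mem q ht)
    gcongr
  have hge : F - ε * (1 + ρ) ^ 2 ≤ 2 * (n * (sInf (q '' S) - c)) := by
    have h1 : (F - ε * (1 + ρ) ^ 2) / (2 * n) + c ≤ sInf (q '' S) := by
      refine le_csInf ⟨_, mem_image_of_mem q ht₀⟩ ?_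
      rintro _ ⟨t, ht, rfl⟩
      rw [← le_sub_iff_add_le, div_le_iff₀ (by positivity)]
      linarith [hlow t ht]
    rw [← le_sub_iff_add_le, div_le_iff₀ (by positivity)] at h1
    linarith
  have hle : 2 * (n * (sInf (q '' S) - c)) - ε * (1 + ρ) ^ 2 ≤ F := by
    refine le_csInf ⟨_, mem_image_of_mem _ (zero_mem_linkLocal n τ ht₀)⟩ ?_
    rintro _ ⟨_, ⟨t, ht, rfl⟩, rfl⟩
    have hnorm : ‖√(n : ℝ) • (link τ t - link τ t₀)‖ = √(n : ℝ) * ‖link τ t - link τ t₀‖ := by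
      rw [norm_smul, Real.norm_of_nonneg hsq.le]
    simp only
    rcases lt_or_ge ρ ‖√(n : ℝ) • (link τ t - link τ t₀)‖ with hb | hb
    · have h2 := hbig _ hb
      have h3 := hinf t₀ ht₀
      have h4 := (abs_le.1 h0).2
      have h5 : 0 ≤ ε * (1 + ‖√(n : ℝ) • (link τ t - link τ t₀)‖) ^ 2 := by positivity
      linarith
    · rw [hnorm] at hb
      have h1 : ‖link τ t - link τ t₀‖ ≤ η := le_of_mul_le_mul_left (hb.trans hρ) hsq
      have h2 := (abs_le.1 (hnear t ht h1)).2
      have h3 : ε * (1 + √(n : ℝ) * ‖link τ t - link τ t₀‖) ^ 2 ≤ ε * (1 + ρ) ^ 2 := by gcongr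
      linarith [hinf t ht]
  rw [abs_le]; constructor <;> linarith

end Localization

/-! ### Stochastic approximation of the QLR statistic -/

section Stochastic

variable {Ω : ℕ → Type*} [∀ n, MeasurableSpace (Ω n)] {P : ∀ n, Measure (Ω n)}

/-- If `X n (η n) = o_p(1)` for all positive `η n → 0`, then `X n η` is small with high probability
for a fixed `η`; otherwise a sequence `η n → 0` along which it is not can be pieced together. -/
theorem exists_eventually_measure_le {X : ∀ n, ℝ → Ω n → ℝ≥0∞}
    (h : ∀ η : ℕ → ℝ, (∀ n, 0 < η n) → Tendsto η atTop (𝓝 0) →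
      ToZeroInProb P (fun n ω => X n (η n) ω)) {ε ε₀ : ℝ≥0∞} (hε : 0 < ε) (hε₀ : 0 < ε₀) :
    ∃ η : ℝ, 0 < η ∧ ∀ᶠ n in atTop, P n {ω | ε < X n η ω} ≤ ε₀ := by
  by_contra! hc
  have hfr : ∀ k : ℕ, ∃ᶠ n in atTop, ¬ P n {ω | ε < X n (1 / ((k : ℝ) + 1)) ω} ≤ ε₀ :=
    fun k => (hc (1 / ((k : ℝ) + 1)) (by positivity)).mono fun n => not_le.2
  obtain ⟨φ, hφ, hbad⟩ := extraction_forall_of_frequently hfr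
  set η : ℕ → ℝ := Function.extend φ (fun k => 1 / ((k : ℝ) + 1)) fun n => 1 / ((n : ℝ) + 1)
    with hη
  have hηφ : ∀ k, η (φ k) = 1 / ((k : ℝ) + 1) := fun k => hφ.injective.extend_apply _ _ k
  have hη' : ∀ n, (∀ k, φ k ≠ n) → η n = 1 / ((n : ℝ) + 1) := fun n hn =>
    Function.extend_apply' _ _ _ (by rintro ⟨k, hk⟩; exact hn k hk)
  have hpos : ∀ n, 0 < η n := fun n => by
    by_cases hn : ∃ k, φ k = n
    · obtain ⟨k, rfl⟩ := hn
      rw [hηφ]; positivity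
    · push Not at hn
      rw [hη' n hn]; positivity
  have hlim : Tendsto η atTop (𝓝 0) := by
    refine (nhds_basis_Ioo_pos (0 : ℝ)).tendsto_right_iff.2 fun r hr => ?_
    obtain ⟨k, hk⟩ := exists_nat_one_div_lt hr
    filter_upwards [eventually_ge_atTop (max k (φ k))] with n hn
    refine ⟨by linarith [hpos n], lt_of_le_of_lt ?_ (hk.trans_eq (zero_add r).symm)⟩
    by_cases hj : ∃ j, φ j = n
    · obtain ⟨j, rfl⟩ := hj
      rw [hηφ]
      exact Nat.one_div_le_one_div (hφ.le_iff_le.1 ((le_max_right _ _).trans hn))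
    · push Not at hj
      rw [hη' n hj]
      exact Nat.one_div_le_one_div ((le_max_left _ _).trans hn)
  have h1 := (ENNReal.tendsto_nhds_zero.1 (h η hpos hlim ε hε)) ε₀ hε₀
  obtain ⟨k, hk⟩ := (hφ.tendsto_atTop.eventually h1).exists
  exact hbad k (by simpa only [hηφ] using hk)

theorem le_of_not_lt_iSup_ofReal {X : Type*} {S : Set X} {f : X → ℝ} {ε : ℝ} (hε : 0 ≤ ε)
    (h : ¬ ENNReal.ofReal ε < ⨆ t ∈ S, ENNReal.ofReal (f t)) {t : X} (ht : t ∈ S) : f t ≤ ε :=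
  (ENNReal.ofReal_le_ofReal_iff hε).1
    ((le_iSup₂ (f := fun t (_ : t ∈ S) => ENNReal.ofReal (f t)) t ht).trans (not_lt.1 h))

theorem abs_quad_le {ι : Type*} [Fintype ι] {A : Matrix ι ι ℝ} {ε : ℝ} (hε : 0 ≤ ε)
    (hA : ∀ i j, |A i j| ≤ ε)
    (v : EuclideanSpace ℝ ι) : |quad A v.ofLp| ≤ ε * (Fintype.card ι) ^ 2 * ‖v‖ ^ 2 := by
  have hn : ∀ i, |v.ofLp i| ≤ ‖v‖ := fun i => by simpa using PiLp.norm_apply_le v i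
  have h1 : quad A v.ofLp = ∑ i, ∑ j, v.ofLp i * (A i j * v.ofLp j) := by
    simp [quad, dotProduct, Matrix.mulVec, Finset.mul_sum]
  rw [h1]
  calc |∑ i, ∑ j, v.ofLp i * (A i j * v.ofLp j)|
      ≤ ∑ i, ∑ j, |v.ofLp i * (A i j * v.ofLp j)| :=
        (Finset.abs_sum_le_sum_abs _ _).trans
          (Finset.sum_le_sum fun i _ => Finset.abs_sum_le_sum_abs _ _)
    _ ≤ ∑ _i : ι, ∑ _j : ι, ‖v‖ * (ε * ‖v‖) := by
        refine Finset.sum_le_sum fun i _ => Finset.sum_le_sum fun j _ => ?_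
        rw [abs_mul, abs_mul]
        gcongr
        · exact hn i
        · exact hA i j
        · exact hn j
    _ = ε * (Fintype.card ι) ^ 2 * ‖v‖ ^ 2 := by
        simp; ring

variable {dp db dt k₁ k₂ : ℕ}

/-- Consistency: with probability approaching one, no parameter with reduced-form value outside a
fixed neighbourhood of `δ_n` beats `θ_n`. -/
theorem tendsto_measure_far {Θo : Set (Vec dp × Vec db)} {τ : Vec dp × Vec db → Vec dt}
    {θ : ℕ → Vec dp × Vec db} {θs : Vec dp × Vec db} {Q : ∀ n, Ω n → Vec dp × Vec db → ℝ}
    {T : ∀ n, Ω n → Vec₂ dp dt → ℝ} (hQT : ReducedFormObjective P Θo τ θ Q T)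
    (hT : ReducedFormIdentified P Θo τ θs T) (hθo : ∀ n, θ n ∈ Θo) (hθso : θs ∈ Θo)
    (hδ : Tendsto (fun n => link τ (θ n)) atTop (𝓝 (link τ θs))) {η : ℝ} (hη : 0 < η) :
    Tendsto (fun n => P n {ω | ∃ t ∈ Θo, η < ‖link τ t - link τ (θ n)‖ ∧ Q n ω t < Q n ω (θ n)})
      atTop (𝓝 0) := by
  obtain ⟨-, hQ, -⟩ := hQT
  obtain ⟨Tl, hcont, hTn, hid⟩ := hT
  obtain ⟨ε, hε, hsep⟩ := hid (Metric.ball (link τ θs) (η / 2))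
    (Metric.ball_mem_nhds _ (half_pos hη))
  have hε8 : (0 : ℝ≥0∞) < ENNReal.ofReal (ε / 8) := ENNReal.ofReal_pos.2 (by positivity)
  have hlimit := (hQ _ hε8).add (hTn _ hε8)
  rw [add_zero] at hlimit
  have hTl : Tendsto (fun n => Tl (link τ (θ n))) atTop (𝓝 (Tl (link τ θs))) :=
    (hcont _ (mem_image_of_mem _ hθso)).tendsto.comp
      (tendsto_nhdsWithin_iff.2 ⟨hδ, Eventually.of_forall fun n => mem_image_of_mem _ (hθo n)⟩)
  refine tendsto_of_tendsto_of_tendsto_of_le_of_le' tendsto_const_nhds hlimit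
    (Eventually.of_forall fun _ => zero_le) ?_
  filter_upwards [hδ.eventually (Metric.ball_mem_nhds _ (half_pos hη)),
    hTl.eventually (eventually_le_nhds (lt_add_of_pos_right _ (by positivity : 0 < ε / 4)))]
    with n hn1 hn2
  refine (measure_mono ?_).trans (measure_union_le _ _)
  rintro ω ⟨t, ht, hfar, hlt⟩
  by_contra hc
  rw [mem_union, not_or] at hc
  have hq := fun {t} (ht : t ∈ Θo) => abs_le.1 (le_of_not_lt_iSup_ofReal (by positivity) hc.1 ht)
  have ht' := fun {t} (ht : t ∈ Θo) =>
    abs_le.1 (le_of_not_lt_iSup_ofReal (by positivity) hc.2 (mem_image_of_mem (link τ) ht))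
  have hnot : link τ t ∉ Metric.ball (link τ θs) (η / 2) := fun hm => by
    have h1 : dist (link τ t) (link τ (θ n)) < η / 2 + η / 2 :=
      (dist_triangle_right _ _ (link τ θs)).trans_lt (add_lt_add hm hn1)
    rw [dist_eq_norm] at h1
    linarith
  have h1 := hsep _ (mem_image_of_mem _ ht) hnot
  have h2 := hq ht
  have h3 := ht' ht
  have h4 := hq (hθo n)
  have h5 := ht' (hθo n)
  linarith [h2.1, h3.1, h4.2, h5.2]

/-- Exact decomposition of the rescaled objective around `δ₀`: the approximation error of `Q_n` by
`T_n`, the Taylor remainder, and the error in the Hessian. -/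
theorem localized_objective_eq {n : ℕ} {f : Vec₂ dp dt → ℝ} {δ₀ δ : Vec₂ dp dt} {u : ℝ}
    (H : Matrix (Fin dp ⊕ Fin dt) (Fin dp ⊕ Fin dt) ℝ) :
    2 * (n * (u - f δ₀)) - qobj H (√(n : ℝ) • gradient f δ₀) (√(n : ℝ) • (δ - δ₀)) =
      2 * (n * (u - f δ)) + 2 * (n * remainder f δ₀ δ) +
        quad (hessian f δ₀ - H) (√(n : ℝ) • (δ - δ₀)).ofLp := by
  have hs : √(n : ℝ) * √(n : ℝ) = n := Real.mul_self_sqrt (Nat.cast_nonneg n)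
  have hq : ∀ A : Matrix (Fin dp ⊕ Fin dt) (Fin dp ⊕ Fin dt) ℝ,
      quad A (√(n : ℝ) • (δ - δ₀)).ofLp = n * quad A (δ - δ₀).ofLp := fun A => by
    rw [WithLp.ofLp_smul, quad_smul, pow_two, hs]
  have hsub : ∀ v : Fin dp ⊕ Fin dt → ℝ,
      quad (hessian f δ₀ - H) v = quad (hessian f δ₀) v - quad H v := fun v => by
    simp [quad, Matrix.sub_mulVec]
  have hlin : (√(n : ℝ) • gradient f δ₀).ofLp ⬝ᵥ (√(n : ℝ) • (δ - δ₀)).ofLp =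
      n * ((gradient f δ₀).ofLp ⬝ᵥ (δ - δ₀).ofLp) := by
    rw [WithLp.ofLp_smul, WithLp.ofLp_smul, smul_dotProduct, dotProduct_smul, smul_eq_mul,
      smul_eq_mul, ← mul_assoc, hs]
  rw [hq, hsub, qobj, hq, hlin, remainder]
  ring

/-- Near `δ_n`, the rescaled objective is uniformly close to its quadratic approximation, relative
to `(1 + √n ‖δ - δ_n‖)²`. -/
theorem exists_near_approx {Θo : Set (Vec dp × Vec db)} {τ : Vec dp × Vec db → Vec dt}
    {θ : ℕ → Vec dp × Vec db} {Q : ∀ n, Ω n → Vec dp × Vec db → ℝ}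
    {T : ∀ n, Ω n → Vec₂ dp dt → ℝ} {H : Matrix (Fin dp ⊕ Fin dt) (Fin dp ⊕ Fin dt) ℝ}
    (hQT : ReducedFormObjective P Θo τ θ Q T) (hQE : QuadraticExpansion P Θo τ θ T)
    (hH : ∀ i j, ToZeroInProb P
      (fun n ω => ENNReal.ofReal |hessian (T n ω) (link τ (θ n)) i j - H i j|))
    {ε : ℝ} (hε : 0 < ε) {ε₀ : ℝ≥0∞} (hε₀ : 0 < ε₀) :
    ∃ η : ℝ, 0 < η ∧ ∀ᶠ n in atTop, P n {ω | ∃ t ∈ Θo, ‖link τ t - link τ (θ n)‖ ≤ η ∧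
      ε * (1 + √(n : ℝ) * ‖link τ t - link τ (θ n)‖) ^ 2 <
        |2 * (n * (Q n ω t - T n ω (link τ (θ n)))) -
          qobj H (√(n : ℝ) • gradient (T n ω) (link τ (θ n)))
            (√(n : ℝ) • (link τ t - link τ (θ n)))|} ≤ ε₀ := by
  -- `2 e`, `2 e` and `e N` bound the three errors of `localized_objective_eq`, relative to
  -- `(1 + √n ‖δ - δ_n‖)²`.
  set N : ℝ := (Fintype.card (Fin dp ⊕ Fin dt) : ℝ) ^ 2 with hN
  set e : ℝ := ε / (4 + N) with he
  have hN0 : 0 ≤ N := by positivity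
  have he0 : 0 < e := by positivity
  have heε : e * (4 + N) = ε := div_mul_cancel₀ _ (by positivity)
  have hee : (0 : ℝ≥0∞) < ENNReal.ofReal e := ENNReal.ofReal_pos.2 he0
  have h3 : (0 : ℝ≥0∞) < ε₀ / 3 := ENNReal.div_pos hε₀.ne' (by simp)
  obtain ⟨η₁, hη₁, hA⟩ := exists_eventually_measure_le
    (X := fun n η ω => ⨆ t ∈ {t ∈ Θo | ‖link τ t - link τ (θ n)‖ ≤ η},
      ENNReal.ofReal (n * |Q n ω t - T n ω (link τ t)| /
        (1 + √(n : ℝ) * ‖link τ t - link τ (θ n)‖) ^ 2)) hQT.2.2 hee h3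
  obtain ⟨η₂, hη₂, hB⟩ := exists_eventually_measure_le
    (X := fun n η ω => ⨆ δ ∈ {δ ∈ link τ '' Θo | ‖δ - link τ (θ n)‖ ≤ η},
      ENNReal.ofReal (|n * remainder (T n ω) (link τ (θ n)) δ| /
        (1 + √(n : ℝ) * ‖δ - link τ (θ n)‖) ^ 2)) hQE hee h3
  have hC : Tendsto (fun n => P n (⋃ ij : (Fin dp ⊕ Fin dt) × (Fin dp ⊕ Fin dt),
      {ω | ENNReal.ofReal e <
        ENNReal.ofReal |hessian (T n ω) (link τ (θ n)) ij.1 ij.2 - H ij.1 ij.2|}))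
      atTop (𝓝 0) := by
    have hsum := tendsto_finsetSum (Finset.univ : Finset ((Fin dp ⊕ Fin dt) × (Fin dp ⊕ Fin dt)))
      fun ij _ => hH ij.1 ij.2 _ hee
    rw [Finset.sum_const_zero] at hsum
    exact tendsto_of_tendsto_of_tendsto_of_le_of_le tendsto_const_nhds hsum (fun _ => zero_le)
      fun n => measure_iUnion_fintype_le _ _
  refine ⟨min η₁ η₂, lt_min hη₁ hη₂, ?_⟩
  filter_upwards [hA, hB, ENNReal.tendsto_nhds_zero.1 hC _ h3] with n hn1 hn2 hn3
  refine (measure_mono ?_).trans (((measure_union_le _ _).trans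
    (add_le_add ((measure_union_le _ _).trans (add_le_add hn1 hn2)) hn3)).trans_eq
      (ENNReal.add_thirds ε₀))
  rintro ω ⟨t, ht, hle, hlt⟩
  by_contra hc
  rw [mem_union, mem_union, not_or, not_or] at hc
  obtain ⟨⟨hc1, hc2⟩, hc3⟩ := hc
  have hb : 0 < 1 + √(n : ℝ) * ‖link τ t - link τ (θ n)‖ := by positivity
  have h1 := le_of_not_lt_iSup_ofReal he0.le hc1
    (show t ∈ {t ∈ Θo | ‖link τ t - link τ (θ n)‖ ≤ η₁} from ⟨ht, hle.trans (min_le_left _ _)⟩)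
  have h2 := le_of_not_lt_iSup_ofReal he0.le hc2
    (show link τ t ∈ {δ ∈ link τ '' Θo | ‖δ - link τ (θ n)‖ ≤ η₂} from
      ⟨mem_image_of_mem _ ht, hle.trans (min_le_right _ _)⟩)
  rw [div_le_iff₀ (by positivity)] at h1 h2
  have h4 : |quad (hessian (T n ω) (link τ (θ n)) - H)
      (√(n : ℝ) • (link τ t - link τ (θ n))).ofLp| ≤
        e * N * ‖√(n : ℝ) • (link τ t - link τ (θ n))‖ ^ 2 := by
    refine abs_quad_le he0.le (fun i j => ?_) _
    have := fun hlt => hc3 (mem_iUnion.2 ⟨(i, j), hlt⟩)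
    exact (ENNReal.ofReal_le_ofReal_iff he0.le).1 (not_lt.1 this)
  rw [norm_smul, Real.norm_of_nonneg (Real.sqrt_nonneg _)] at h4
  have h5 : e * N * (√(n : ℝ) * ‖link τ t - link τ (θ n)‖) ^ 2 ≤
      e * N * (1 + √(n : ℝ) * ‖link τ t - link τ (θ n)‖) ^ 2 := by
    gcongr; linarith
  rw [localized_objective_eq] at hlt
  have h6 := (abs_add_three (2 * (n * (Q n ω t - T n ω (link τ t))))
    (2 * (n * remainder (T n ω) (link τ (θ n)) (link τ t)))
    (quad (hessian (T n ω) (link τ (θ n)) - H) (√(n : ℝ) • (link τ t - link τ (θ n))).ofLp))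
  rw [abs_mul 2 _, abs_mul 2 _, abs_mul (n : ℝ) (Q n ω t - _), abs_two, Nat.abs_cast] at h6
  rw [← heε] at hlt
  nlinarith

/-- On the events `‖√n ∂T_n(δ_n)‖ ≤ K`, the QLR statistic is within `o_p(1)` of the difference of
the infima of the quadratic approximation over the two localized parameter spaces. -/
theorem tendsto_measure_qlr_approx {Θ Θo Θr : Set (Vec dp × Vec db)}
    {τ : Vec dp × Vec db → Vec dt}
    {θ : ℕ → Vec dp × Vec db} {θs : Vec dp × Vec db} {Q : ∀ n, Ω n → Vec dp × Vec db → ℝ}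
    {T : ∀ n, Ω n → Vec₂ dp dt → ℝ} {H : Matrix (Fin dp ⊕ Fin dt) (Fin dp ⊕ Fin dt) ℝ}
    (hQT : ReducedFormObjective P Θo τ θ Q T)
    (hT : ReducedFormIdentified P Θo τ θs T) (hQE : QuadraticExpansion P Θo τ θ T)
    (hPD : H.PosDef) (hH : ∀ i j, ToZeroInProb P
      (fun n ω => ENNReal.ofReal |hessian (T n ω) (link τ (θ n)) i j - H i j|))
    (hΘ : Θ ⊆ Θo) (hΘr : Θr ⊆ Θ) (hθr : ∀ n, θ n ∈ Θr) (hθso : θs ∈ Θo)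
    (hδ : Tendsto (fun n => link τ (θ n)) atTop (𝓝 (link τ θs))) (K : ℝ) {ε : ℝ} (hε : 0 < ε) :
    Tendsto (fun n => P n {ω | ‖√(n : ℝ) • gradient (T n ω) (link τ (θ n))‖ ≤ K ∧
      ε < |qlr n (Q n ω) Θ Θr -
        (infObj H (linkLocal n τ (θ n) Θr) (√(n : ℝ) • gradient (T n ω) (link τ (θ n))) -
          infObj H (linkLocal n τ (θ n) Θ) (√(n : ℝ) • gradient (T n ω) (link τ (θ n))))|})
      atTop (𝓝 0) := by
  obtain ⟨r, hr0, hr⟩ := exists_quad_lower hPD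
  set ρ := 1 + 4 * K / r with hρ
  obtain ⟨e, he0, he1, he2⟩ : ∃ e : ℝ, 0 < e ∧ 8 * e ≤ r ∧ e * (1 + ρ) ^ 2 ≤ ε / 2 := by
    refine ⟨min (r / 8) (ε / 2 / ((1 + ρ) ^ 2 + 1)), by positivity, ?_, ?_⟩
    · linarith [min_le_left (r / 8) (ε / 2 / ((1 + ρ) ^ 2 + 1))]
    · calc _ ≤ ε / 2 / ((1 + ρ) ^ 2 + 1) * ((1 + ρ) ^ 2 + 1) := by
            gcongr
            · exact min_le_right _ _
            · linarith
        _ = ε / 2 := div_mul_cancel₀ _ (by positivity)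
  rw [ENNReal.tendsto_nhds_zero]
  intro ε₀ hε₀
  obtain ⟨η, hη, hnear⟩ := exists_near_approx hQT hQE hH he0 (ENNReal.half_pos hε₀.ne')
  have hfar := ENNReal.tendsto_nhds_zero.1 (tendsto_measure_far hQT hT
    (fun n => hΘ (hΘr (hθr n))) hθso hδ hη) _ (ENNReal.half_pos hε₀.ne')
  have hlarge : ∀ᶠ n : ℕ in atTop, ρ ≤ √(n : ℝ) * η :=
    ((Real.tendsto_sqrt_atTop.comp tendsto_natCast_atTop_atTop).atTop_mul_const hη).eventually
      (eventually_ge_atTop ρ)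
  filter_upwards [hnear, hfar, hlarge, eventually_gt_atTop 0] with n hn1 hn2 hn3 hn4
  refine (measure_mono ?_).trans (((measure_union_le _ _).trans (add_le_add hn1 hn2)).trans_eq
    (ENNReal.add_halves ε₀))
  rintro ω ⟨hK, hlt⟩
  by_contra hc
  rw [mem_union, not_or] at hc
  obtain ⟨hc1, hc2⟩ := hc
  simp only [mem_ofPred_eq, not_exists, not_and, not_lt] at hc1 hc2
  have key : ∀ S ⊆ Θo, θ n ∈ S → |2 * (n * (sInf (Q n ω '' S) - T n ω (link τ (θ n)))) -
      infObj H (linkLocal n τ (θ n) S) (√(n : ℝ) • gradient (T n ω) (link τ (θ n)))| ≤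
        ε / 2 := fun S hS hmem =>
    (abs_sInf_sub_infObj_le hn4 hmem hPD hr0 hr hK hη he0 he1 hn3
      (fun t ht => hc2 t (hS ht)) (fun t ht => hc1 t (hS ht))).trans he2
  have h1 := abs_le.1 (key Θ hΘ (hΘr (hθr n)))
  have h2 := abs_le.1 (key Θr (hΘr.trans hΘ) (hθr n))
  rw [qlr] at hlt
  rcases lt_abs.1 hlt with h | h <;> linarith [h1.1, h1.2, h2.1, h2.2]

end Stochastic

/-! ### Convergence in distribution -/

section Distribution

variable {Ω : ℕ → Type*} [∀ n, MeasurableSpace (Ω n)] {P : ∀ n, Measure (Ω n)}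
  [∀ n, IsProbabilityMeasure (P n)] {Ω' : Type*} [MeasurableSpace Ω'] {P' : Measure Ω'}
  [IsProbabilityMeasure P']

/-- Slutsky's lemma on varying probability spaces: real random variables that differ from a sequence
converging in distribution by `o_p(1)` have the same limit. -/
theorem tendstoInDistribution_of_abs_sub {X Z : ∀ n, Ω n → ℝ} {W : Ω' → ℝ}
    (hZ : TendstoInDistribution Z atTop W P P') (hX : ∀ n, AEMeasurable (X n) (P n))
    (h : ∀ ε : ℝ, 0 < ε → Tendsto (fun n => P n {ω | ε < |X n ω - Z n ω|}) atTop (𝓝 0)) :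
    TendstoInDistribution X atTop W P P' where
  forall_aemeasurable := hX
  aemeasurable_limit := hZ.aemeasurable_limit
  tendsto := by
    refine tendsto_of_forall_isClosed_limsup_le' fun F hF => ?_
    have : IsProbabilityMeasure (P'.map W) :=
      Measure.isProbabilityMeasure_map hZ.aemeasurable_limit
    refine le_of_forall_gt fun b hb => ?_
    obtain ⟨b₁, hb₁, hb₂⟩ := exists_between hb
    obtain ⟨b₂, hb₂, hb₃⟩ := exists_between hb₂
    -- A closed thickening of `F` still has limiting probability below `b₁`.
    have hth : ∀ᶠ r in 𝓝[>] (0 : ℝ), (P'.map W) (Metric.cthickening r F) < b₁ :=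
      ((tendsto_measure_cthickening_of_isClosed (μ := P'.map W) (s := F)
        ⟨1, one_pos, measure_ne_top _ _⟩ hF).mono_left nhdsWithin_le_nhds).eventually
        (eventually_lt_nhds hb₁)
    obtain ⟨r, hr, hr0⟩ := (hth.and self_mem_nhdsWithin).exists
    have hr0 : 0 < r := hr0
    have h1 := (ProbabilityMeasure.limsup_measure_closed_le_of_tendsto hZ.tendsto
      (Metric.isClosed_cthickening (δ := r) (E := F))).trans_lt hr
    have h2 := eventually_lt_of_limsup_lt h1
    have h3 := (h r hr0).eventually (eventually_le_nhds (tsub_pos_of_lt hb₂))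
    refine lt_of_le_of_lt ?_ hb₃
    refine limsup_le_of_le (by isBoundedDefault) ?_
    filter_upwards [h2, h3] with n hn2 hn3
    simp only [ProbabilityMeasure.coe_mk] at hn2 ⊢
    rw [Measure.map_apply_of_aemeasurable (hX n) hF.measurableSet]
    rw [Measure.map_apply_of_aemeasurable (hZ.forall_aemeasurable n)
      Metric.isClosed_cthickening.measurableSet] at hn2
    have hsub : X n ⁻¹' F ⊆ Z n ⁻¹' Metric.cthickening r F ∪ {ω | r < |X n ω - Z n ω|} := by
      intro ω hω
      by_cases hc : r < |X n ω - Z n ω|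
      · exact Or.inr hc
      · refine Or.inl (Metric.mem_cthickening_of_dist_le _ (X n ω) r F hω ?_)
        rw [dist_comm, Real.dist_eq]; exact not_lt.1 hc
    calc P n (X n ⁻¹' F) ≤ P n (Z n ⁻¹' Metric.cthickening r F) + P n {ω | r < |X n ω - Z n ω|} :=
          (measure_mono hsub).trans (measure_union_le _ _)
      _ ≤ b₁ + (b₂ - b₁) := add_le_add hn2.le hn3
      _ = b₂ := add_tsub_cancel_of_le hb₂.le

variable {E : Type*} [NormedAddCommGroup E] [MeasurableSpace E] [BorelSpace E]

theorem continuous_of_tendsto_prod {X Z : Type*} [TopologicalSpace X] [TopologicalSpace Z]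
    [RegularSpace Z] {G : ℕ → X → Z} {g : X → Z}
    (h : ∀ x, Tendsto (fun p : ℕ × X => G p.1 p.2) (atTop ×ˢ 𝓝 x) (𝓝 (g x))) : Continuous g := by
  refine continuous_iff_continuousAt.2 fun x => ?_
  refine (closed_nhds_basis (g x)).tendsto_right_iff.2 fun V hV => ?_
  obtain ⟨pa, ha, pb, hb, hab⟩ := eventually_prod_iff.1 ((h x).eventually hV.1)
  filter_upwards [hb] with z hz
  have h1 : Tendsto (fun n => G n z) atTop (𝓝 (g z)) :=
    (h z).comp (tendsto_id.prodMk tendsto_const_nhds)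
  refine hV.2.mem_of_tendsto h1 ?_
  filter_upwards [ha] with n hn using hab hn hz

theorem exists_eventually_measure_norm_gt_le {Y : ∀ n, Ω n → E} {W : Ω' → E}
    (hY : TendstoInDistribution Y atTop W P P') {ε : ℝ≥0∞} (hε : 0 < ε) :
    ∃ K : ℝ, ∀ᶠ n in atTop, P n {ω | K < ‖Y n ω‖} ≤ ε := by
  have : IsProbabilityMeasure (P'.map W) :=
    Measure.isProbabilityMeasure_map hY.aemeasurable_limit
  have hcl : ∀ k : ℕ, IsClosed {x : E | (k : ℝ) ≤ ‖x‖} := fun k =>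
    isClosed_le continuous_const continuous_norm
  have h1 : Tendsto (fun k : ℕ => (P'.map W) {x : E | (k : ℝ) ≤ ‖x‖}) atTop (𝓝 0) := by
    have h2 := tendsto_measure_iInter_atTop (μ := P'.map W)
      (s := fun k : ℕ => {x : E | (k : ℝ) ≤ ‖x‖})
      (fun k => (hcl k).measurableSet.nullMeasurableSet)
      (fun i j hij x hx => (Nat.cast_le (α := ℝ).2 hij).trans (hx : (j : ℝ) ≤ ‖x‖))
      ⟨0, measure_ne_top _ _⟩
    have h3 : ⋂ k : ℕ, {x : E | (k : ℝ) ≤ ‖x‖} = ∅ := by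
      refine eq_empty_of_forall_notMem fun x hx => ?_
      obtain ⟨k, hk⟩ := exists_nat_gt ‖x‖
      exact absurd (mem_iInter.1 hx k) (not_le.2 hk)
    rwa [h3, measure_empty] at h2
  obtain ⟨k, hk⟩ := (h1.eventually (eventually_lt_nhds hε)).exists
  refine ⟨k, ?_⟩
  have h4 := eventually_lt_of_limsup_lt
    ((ProbabilityMeasure.limsup_measure_closed_le_of_tendsto hY.tendsto (hcl k)).trans_lt hk)
  filter_upwards [h4] with n hn
  simp only [ProbabilityMeasure.coe_mk] at hn
  rw [Measure.map_apply_of_aemeasurable (hY.forall_aemeasurable n) (hcl k).measurableSet] at hn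
  exact (measure_mono fun ω (hω : (k : ℝ) < ‖Y n ω‖) => hω.le).trans hn.le

/-- Extended continuous mapping theorem: if `Y n` converges in distribution, the functions `G n`
converge continuously to `g`, and `X n` is within `o_p(1)` of `G n (Y n)` on the events
`‖Y n‖ ≤ K`, then `X n` converges in distribution to the image of the limit under `g`. -/
theorem tendstoInDistribution_of_tendsto_prod [ProperSpace E] {Y : ∀ n, Ω n → E} {W : Ω' → E}
    (hY : TendstoInDistribution Y atTop W P P') {G : ℕ → E → ℝ} {g : E → ℝ}
    (hG : ∀ y, Tendsto (fun p : ℕ × E => G p.1 p.2) (atTop ×ˢ 𝓝 y) (𝓝 (g y)))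
    {X : ∀ n, Ω n → ℝ} (hX : ∀ n, AEMeasurable (X n) (P n))
    (h : ∀ K ε : ℝ, 0 < ε →
      Tendsto (fun n => P n {ω | ‖Y n ω‖ ≤ K ∧ ε < |X n ω - G n (Y n ω)|}) atTop (𝓝 0)) :
    TendstoInDistribution X atTop (fun ω => g (W ω)) P P' := by
  have hg : Continuous g := continuous_of_tendsto_prod hG
  refine tendstoInDistribution_of_abs_sub (hY.continuous_comp hg) hX fun ε hε => ?_
  rw [ENNReal.tendsto_nhds_zero]
  intro ε₀ hε₀
  obtain ⟨K, hK⟩ := exists_eventually_measure_norm_gt_le hY (ENNReal.half_pos hε₀.ne')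
  have hunif : ∀ᶠ n in atTop, ∀ y ∈ Metric.closedBall (0 : E) K, |G n y - g y| < ε / 2 := by
    have hloc : TendstoLocallyUniformly G g atTop := by
      rw [tendstoLocallyUniformly_iff_forall_tendsto]
      intro y
      exact tendsto_uniformity_iff_dist_tendsto_zero.2 (by
        simpa using ((hg.tendsto y).comp tendsto_snd).dist (hG y))
    have := (tendstoLocallyUniformlyOn_iff_tendstoUniformlyOn_of_compact
      (isCompact_closedBall (0 : E) K)).1 hloc.tendstoLocallyUniformlyOn
    filter_upwards [Metric.tendstoUniformlyOn_iff.1 this (ε / 2) (half_pos hε)] with n hn y hy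
    rw [← Real.dist_eq, dist_comm]; exact hn y hy
  filter_upwards [hK, hunif, (ENNReal.tendsto_nhds_zero.1 (h K (ε / 2) (half_pos hε)))
    (ε₀ / 2) (ENNReal.half_pos hε₀.ne')] with n hn1 hn2 hn3
  have hsub : {ω | ε < |X n ω - (g ∘ Y n) ω|} ⊆
      {ω | K < ‖Y n ω‖} ∪ {ω | ‖Y n ω‖ ≤ K ∧ ε / 2 < |X n ω - G n (Y n ω)|} := by
    intro ω hω
    rcases lt_or_ge K ‖Y n ω‖ with hc | hc
    · exact Or.inl hc
    · refine Or.inr ⟨hc, ?_⟩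
      have h1 := hn2 (Y n ω) (by simpa using hc)
      have h2 := abs_sub_le (X n ω) (G n (Y n ω)) (g (Y n ω))
      have h3 : ε < |X n ω - g (Y n ω)| := hω
      linarith
  calc _ ≤ _ := measure_mono hsub
    _ ≤ _ := measure_union_le _ _
    _ ≤ ε₀ / 2 + ε₀ / 2 := add_le_add hn1 hn3
    _ = ε₀ := ENNReal.add_halves ε₀

end Distribution

/-! ### Matrices as linear maps, and derivatives -/

section LinearMaps

variable {ι κ : Type*} [Fintype κ]

theorem injective_mulVec_of_rank {A : Matrix ι κ ℝ} (hA : A.rank = Fintype.card κ) :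
    Function.Injective A.mulVec := by
  have h1 := LinearMap.finrank_range_add_finrank_ker A.mulVecLin
  have h2 : Module.finrank ℝ (LinearMap.range A.mulVecLin) = Fintype.card κ := hA
  rw [h2, Module.finrank_fintype_fun_eq_card] at h1
  have h3 : LinearMap.ker A.mulVecLin = ⊥ := Submodule.finrank_eq_zero.1 (by omega)
  exact LinearMap.ker_eq_bot.1 h3

variable [Fintype ι]

theorem surjective_mulVec_of_rank {A : Matrix ι κ ℝ} (hA : A.rank = Fintype.card ι) :
    Function.Surjective A.mulVec := by
  have h2 : Module.finrank ℝ (LinearMap.range A.mulVecLin) = Fintype.card ι := hA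
  have h3 : LinearMap.range A.mulVecLin = ⊤ :=
    Submodule.eq_top_of_finrank_eq (by rw [h2, Module.finrank_fintype_fun_eq_card])
  exact LinearMap.range_eq_top.1 h3

variable [DecidableEq κ]

/-- Multiplication by a matrix, as a continuous linear map of Euclidean spaces. -/
noncomputable def mulVecL (A : Matrix ι κ ℝ) : EuclideanSpace ℝ κ →L[ℝ] EuclideanSpace ℝ ι :=
  LinearMap.toContinuousLinearMap (Matrix.toEuclideanLin A)

@[simp] theorem mulVecL_apply (A : Matrix ι κ ℝ) (v : EuclideanSpace ℝ κ) :
    mulVecL A v = WithLp.toLp 2 (A *ᵥ v.ofLp) :=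
  Matrix.toLpLin_apply 2 2 A v

theorem continuous_mulVecL : Continuous (mulVecL : Matrix ι κ ℝ → _) :=
  LinearMap.continuous_of_finiteDimensional
    ((LinearMap.toContinuousLinearMap.toLinearMap).comp
      (Matrix.toEuclideanLin (𝕜 := ℝ) (m := ι) (n := κ)).toLinearMap)

/-- A matrix of full column rank is bounded below. -/
theorem exists_mulVecL_lower {A : Matrix ι κ ℝ} (hA : A.rank = Fintype.card κ) :
    ∃ r : ℝ, 0 < r ∧ ∀ v, r * ‖v‖ ≤ ‖mulVecL A v‖ := by
  have hker : LinearMap.ker (Matrix.toEuclideanLin A) = ⊥ := by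
    refine LinearMap.ker_eq_bot.2 fun v w hvw => ?_
    have h1 : WithLp.toLp 2 (A *ᵥ v.ofLp) = WithLp.toLp 2 (A *ᵥ w.ofLp) := by
      rw [← mulVecL_apply, ← mulVecL_apply]; exact hvw
    exact WithLp.ofLp_injective 2
      (injective_mulVec_of_rank hA (WithLp.toLp_injective 2 h1))
  obtain ⟨K, hK, hanti⟩ := LinearMap.exists_antilipschitzWith _ hker
  have hK' : (0 : ℝ) < K := hK
  refine ⟨(K : ℝ)⁻¹, inv_pos.2 hK', fun v => ?_⟩
  have h1 := hanti.le_mul_dist v 0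
  rw [dist_zero_right, map_zero, dist_zero_right] at h1
  rw [inv_mul_le_iff₀ hK']
  exact h1

end LinearMaps

theorem mulVecL_jacobian {d e : ℕ} (f : Vec d → Vec e) (x : Vec d) :
    mulVecL (jacobian f x) = fderiv ℝ f x := by
  ext v i
  have hv : v = ∑ j, v.ofLp j • EuclideanSpace.single j (1 : ℝ) := by
    ext k; simp [Pi.single_apply]
  conv_rhs => rw [hv, map_sum]
  simp [jacobian, Matrix.mulVec, dotProduct, mul_comm]

variable {dp db dt k₁ k₂ : ℕ}

theorem mulVecL_dτπ {τ : Vec dp × Vec db → Vec dt} {θ : Vec dp × Vec db}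
    (h : DifferentiableAt ℝ τ θ) (v : Vec dp) : mulVecL (dτπ τ θ) v = fderiv ℝ τ θ (v, 0) := by
  have h1 : HasFDerivAt (fun p => τ (p, θ.2)) ((fderiv ℝ τ θ).comp
      (ContinuousLinearMap.inl ℝ (Vec dp) (Vec db))) θ.1 :=
    HasFDerivAt.comp θ.1 (g := τ) h.hasFDerivAt (hasFDerivAt_prodMk_left θ.1 θ.2)
  rw [dτπ, mulVecL_jacobian, h1.fderiv]
  simp

theorem hasFDerivAt_dτβ {τ : Vec dp × Vec db → Vec dt} {θ : Vec dp × Vec db}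
    (h : DifferentiableAt ℝ τ θ) : HasFDerivAt (fun b => τ (θ.1, b)) (mulVecL (dτβ τ θ)) θ.2 := by
  have h1 : HasFDerivAt (fun b => τ (θ.1, b)) ((fderiv ℝ τ θ).comp
      (ContinuousLinearMap.inr ℝ (Vec dp) (Vec db))) θ.2 :=
    HasFDerivAt.comp θ.2 (g := τ) h.hasFDerivAt (hasFDerivAt_prodMk_right θ.1 θ.2)
  rw [dτβ, mulVecL_jacobian, h1.fderiv]
  exact h1

theorem mulVecL_dτβ {τ : Vec dp × Vec db → Vec dt} {θ : Vec dp × Vec db}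
    (h : DifferentiableAt ℝ τ θ) (v : Vec db) : mulVecL (dτβ τ θ) v = fderiv ℝ τ θ (0, v) := by
  have h1 : HasFDerivAt (fun b => τ (θ.1, b)) ((fderiv ℝ τ θ).comp
      (ContinuousLinearMap.inr ℝ (Vec dp) (Vec db))) θ.2 :=
    HasFDerivAt.comp θ.2 (g := τ) h.hasFDerivAt (hasFDerivAt_prodMk_right θ.1 θ.2)
  rw [(hasFDerivAt_dτβ h).unique h1]
  simp

/-- Rescaled differences of a strictly differentiable function converge to the derivative. -/
theorem tendsto_smul_sub_of_hasStrictFDerivAt {E F α : Type*} [NormedAddCommGroup E]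
    [NormedSpace ℝ E] [NormedAddCommGroup F] [NormedSpace ℝ F] {f : E → F} {L : E →L[ℝ] F} {a v : E}
    (hf : HasStrictFDerivAt f L a) {l : Filter α} {x y : α → E} {c : α → ℝ}
    (hx : Tendsto x l (𝓝 a)) (hy : Tendsto y l (𝓝 a))
    (hc : Tendsto (fun i => c i • (x i - y i)) l (𝓝 v)) :
    Tendsto (fun i => c i • (f (x i) - f (y i))) l (𝓝 (L v)) := by
  have h1 : (fun i => f (x i) - f (y i) - L (x i - y i)) =o[l] fun i => x i - y i :=
    hf.isLittleO.comp_tendsto (hx.prodMk_nhds hy)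
  have h2 : (fun i => c i • (f (x i) - f (y i) - L (x i - y i))) =o[l] fun _ => (1 : ℝ) :=
    ((Asymptotics.isBigO_refl c l).smul_isLittleO h1).trans_isBigO (hc.isBigO_one ℝ)
  have h3 := ((Asymptotics.isLittleO_one_iff ℝ).1 h2).add ((L.continuous.tendsto v).comp hc)
  rw [zero_add] at h3
  refine h3.congr fun i => ?_
  simp [smul_sub]

/-! ### Stacked vectors -/

/-- The first block of a stacked vector. -/
def fstV {d e : ℕ} (v : Vec₂ d e) : Vec d := WithLp.toLp 2 fun i => v (Sum.inl i)

/-- The second block of a stacked vector. -/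
def sndV {d e : ℕ} (v : Vec₂ d e) : Vec e := WithLp.toLp 2 fun i => v (Sum.inr i)

section Stack

variable {d e : ℕ}

@[simp] theorem fstV_stack (a : Vec d) (b : Vec e) : fstV (stack a b) = a := rfl

@[simp] theorem sndV_stack (a : Vec d) (b : Vec e) : sndV (stack a b) = b := rfl

@[simp] theorem stack_fstV_sndV (v : Vec₂ d e) : stack (fstV v) (sndV v) = v := by
  ext i; cases i <;> rfl

theorem continuous_fstV : Continuous (fstV : Vec₂ d e → Vec d) := by
  unfold fstV; fun_prop

theorem continuous_sndV : Continuous (sndV : Vec₂ d e → Vec e) := by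
  unfold sndV; fun_prop

theorem continuous_stack : Continuous fun p : Vec d × Vec e => stack p.1 p.2 := by
  unfold stack
  refine (PiLp.continuous_toLp 2 _).comp (continuous_pi fun i => ?_)
  cases i <;> simp <;> fun_prop

theorem tendsto_stack {α : Type*} {l : Filter α} {f : α → Vec d} {g : α → Vec e} {a : Vec d}
    {b : Vec e} (hf : Tendsto f l (𝓝 a)) (hg : Tendsto g l (𝓝 b)) :
    Tendsto (fun x => stack (f x) (g x)) l (𝓝 (stack a b)) := by
  have h1 : Tendsto (fun x => (f x, g x)) l (𝓝 (a, b)) := hf.prodMk_nhds hg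
  have h2 := (continuous_stack (d := d) (e := e)).tendsto (a, b)
  simpa only [Function.comp_def] using h2.comp h1

theorem smul_stack_sub_stack (r : ℝ) (a a' : Vec d) (b b' : Vec e) :
    r • (stack a b - stack a' b') = stack (r • (a - a')) (r • (b - b')) := by
  ext i; cases i <;> rfl

end Stack

theorem smul_link_sub_link (r : ℝ) (τ : Vec dp × Vec db → Vec dt) (t t₀ : Vec dp × Vec db) :
    r • (link τ t - link τ t₀) = stack (r • (t.1 - t₀.1)) (r • (τ t - τ t₀)) :=
  smul_stack_sub_stack _ _ _ _ _

/-! ### Limits of parameters in shrinking neighbourhoods -/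

theorem tendsto_zero_of_smul {E α : Type*} [NormedAddCommGroup E] [NormedSpace ℝ E]
    {l : Filter α} {c : α → ℝ} {w : α → E} {p : E} (hc : Tendsto c l atTop)
    (h : Tendsto (fun i => c i • w i) l (𝓝 p)) : Tendsto w l (𝓝 0) := by
  have h1 := (tendsto_inv_atTop_zero.comp hc).smul h
  rw [zero_smul] at h1
  refine h1.congr' ?_
  filter_upwards [hc.eventually (eventually_gt_atTop 0)] with i hi
  simp [smul_smul, inv_mul_cancel₀ hi.ne']

theorem tendsto_of_smul_sub {E α : Type*} [NormedAddCommGroup E] [NormedSpace ℝ E]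
    {l : Filter α} {c : α → ℝ} {x y : α → E} {p z : E} (hc : Tendsto c l atTop)
    (h : Tendsto (fun i => c i • (x i - y i)) l (𝓝 p)) (hy : Tendsto y l (𝓝 z)) :
    Tendsto x l (𝓝 z) := by
  simpa using (tendsto_zero_of_smul hc h).add hy

theorem tendsto_sqrt_natCast {α : Type*} {l : Filter α} {ν : α → ℕ} (hν : Tendsto ν l atTop) :
    Tendsto (fun i => √(ν i : ℝ)) l atTop :=
  (Real.tendsto_sqrt_atTop.comp tendsto_natCast_atTop_atTop).comp hν

section Geometry

variable {dp db dt k₁ k₂ : ℕ} {Θ Θo : Set (Vec dp × Vec db)} {τ : Vec dp × Vec db → Vec dt}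
  {θ : ℕ → Vec dp × Vec db} {θs : Vec dp × Vec db}

theorem mem_crossSec_singleton {π : Vec dp} {β : Vec db} :
    β ∈ crossSec Θ {π} ↔ (π, β) ∈ Θ := by
  simp [crossSec]

/-- Near `π_*` the cross-sections stay in a compact set, so that `β` has limit points, which lie in
`B_*`. -/
theorem exists_tendsto_snd (hPS : RegularParamSpace Θ θs.1) {α : Type*} (U : Ultrafilter α)
    {t : α → Vec dp × Vec db} (ht : ∀ᶠ i in (U : Filter α), t i ∈ Θ)
    (hπ : Tendsto (fun i => (t i).1) U (𝓝 θs.1)) :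
    ∃ β, (θs.1, β) ∈ Θ ∧ Tendsto (fun i => (t i).2) U (𝓝 β) := by
  obtain ⟨hcl, hcpt, M, hM, W, hW, hLip⟩ := hPS
  have hmem : ∀ᶠ i in (U : Filter α),
      (t i).2 ∈ Metric.cthickening (M * 1) (crossSec Θ {θs.1}) := by
    filter_upwards [ht, hπ.eventually hW, hπ.eventually (Metric.closedBall_mem_nhds _ one_pos)]
      with i hi hiW hi1
    rw [Metric.mem_cthickening_iff]
    refine ((Metric.infEDist_le_hausdorffEDist_of_mem (mem_crossSec_singleton.2 hi)).trans
      (hLip _ hiW _ (mem_of_mem_nhds hW))).trans (ENNReal.ofReal_le_ofReal ?_)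
    rw [dist_eq_norm] at hi1
    gcongr
  obtain ⟨β, -, hβ⟩ := exists_tendsto_of_isCompact hcpt.cthickening U hmem
  exact ⟨β, hcl.mem_of_tendsto (hπ.prodMk_nhds hβ) ht, hβ⟩

theorem tendsto_hausdorffEDist_zero {X Z : Type*} [NormedAddCommGroup X] [PseudoEMetricSpace Z]
    {B : X → Set Z} {x : X} {M : ℝ} {x' : ℕ → X} (hx : Tendsto x' atTop (𝓝 x))
    (h : ∀ᶠ n in atTop, Metric.hausdorffEDist (B x) (B (x' n)) ≤ ENNReal.ofReal (M * ‖x - x' n‖)) :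
    Tendsto (fun n => Metric.hausdorffEDist (B x) (B (x' n))) atTop (𝓝 0) := by
  refine tendsto_of_tendsto_of_tendsto_of_le_of_le' tendsto_const_nhds ?_
    (Eventually.of_forall fun _ => zero_le) h
  have h1 : Tendsto (fun n => M * ‖x - x' n‖) atTop (𝓝 0) := by
    simpa using ((tendsto_const_nhds (x := x)).sub hx).norm.const_mul M
  simpa using ENNReal.tendsto_ofReal h1

/-- Lower hemicontinuity of set-valued maps that are Lipschitz in the Hausdorff distance. -/
theorem exists_tendsto_of_hausdorffEDist {X Z : Type*} [NormedAddCommGroup X]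
    [PseudoEMetricSpace Z] {B : X → Set Z} {x : X} {M : ℝ} {x' : ℕ → X}
    (hx : Tendsto x' atTop (𝓝 x))
    (h : ∀ᶠ n in atTop, Metric.hausdorffEDist (B x) (B (x' n)) ≤ ENNReal.ofReal (M * ‖x - x' n‖))
    {z : Z} (hz : z ∈ B x) :
    ∃ u : ℕ → Z, (∀ᶠ n in atTop, u n ∈ B (x' n)) ∧ Tendsto u atTop (𝓝 z) :=
  exists_tendsto_of_infEDist (tendsto_of_tendsto_of_tendsto_of_le_of_le tendsto_const_nhds
    (tendsto_hausdorffEDist_zero hx h) (fun _ => zero_le)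
    fun _ => Metric.infEDist_le_hausdorffEDist_of_mem hz)

theorem hasStrictFDerivAt_of_contDiffOn (hΘo : IsOpen Θo) (hτ : ContDiffOn ℝ 2 τ Θo)
    {t : Vec dp × Vec db} (ht : t ∈ Θo) : HasStrictFDerivAt τ (fderiv ℝ τ t) t :=
  (hτ.contDiffAt (hΘo.mem_nhds ht)).hasStrictFDerivAt (by simp)

/-- The effect on `√n τ` of moving `π` from `π_n` to a point at distance of order `n^{-1/2}`. -/
theorem tendsto_sqrt_smul_sub_left {β : Vec db}
    (hτ : HasStrictFDerivAt τ (fderiv ℝ τ (θs.1, β)) (θs.1, β))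
    (hθ : Tendsto θ atTop (𝓝 θs)) {α : Type*} {l : Filter α} {ν : α → ℕ} (hν : Tendsto ν l atTop)
    {t : α → Vec dp × Vec db} {p : Vec dp}
    (hp : Tendsto (fun i => √(ν i : ℝ) • ((t i).1 - (θ (ν i)).1)) l (𝓝 p))
    (hβ : Tendsto (fun i => (t i).2) l (𝓝 β)) :
    Tendsto (fun i => √(ν i : ℝ) • (τ (t i) - τ ((θ (ν i)).1, (t i).2))) l
      (𝓝 (mulVecL (dτπ τ (θs.1, β)) p)) := by
  have hθ1 : Tendsto (fun i => (θ (ν i)).1) l (𝓝 θs.1) :=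
    (continuous_fst.tendsto θs).comp (hθ.comp hν)
  have hπ : Tendsto (fun i => (t i).1) l (𝓝 θs.1) :=
    tendsto_of_smul_sub (tendsto_sqrt_natCast hν) hp hθ1
  rw [mulVecL_dτπ hτ.hasFDerivAt.differentiableAt]
  refine tendsto_smul_sub_of_hasStrictFDerivAt hτ (x := t) (hπ.prodMk_nhds hβ)
    (hθ1.prodMk_nhds hβ) ?_
  refine (hp.prodMk_nhds (tendsto_const_nhds (x := (0 : Vec db)))).congr fun i => ?_
  ext <;> simp

/-- The limit `c` of the rescaled link functions is continuous at the points of `B_*`: it is a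
uniform limit of functions that are continuous there eventually. -/
theorem continuousWithinAt_of_tendstoUniformlyOn (hΘo : IsOpen Θo) (hτ : ContDiffOn ℝ 2 τ Θo)
    (hθ : Tendsto θ atTop (𝓝 θs)) {a : ℕ → ℝ} {c : Vec db → Vec dt} {B : Set (Vec db)}
    (hc : TendstoUniformlyOn (fun n β => a n • (τ ((θ n).1, β) - τ (θ n))) c atTop B)
    {β : Vec db} (hβ : (θs.1, β) ∈ Θo) (hB : β ∈ B) : ContinuousWithinAt c B β := by
  refine continuousWithinAt_of_locally_uniform_approx_of_continuousWithinAt hB fun u hu => ?_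
  have h1 : Tendsto (fun n => ((θ n).1, β)) atTop (𝓝 (θs.1, β)) :=
    ((continuous_fst.tendsto θs).comp hθ).prodMk_nhds tendsto_const_nhds
  obtain ⟨n, hn, hno⟩ := ((hc u hu).and (h1.eventually (hΘo.mem_nhds hβ))).exists
  refine ⟨B, self_mem_nhdsWithin, _, ?_, hn⟩
  have h2 : ContinuousAt τ ((θ n).1, β) := hτ.continuousOn.continuousAt (hΘo.mem_nhds hno)
  have h3 : ContinuousAt (fun b => τ ((θ n).1, b)) β :=
    ContinuousAt.comp (g := τ) h2 (by fun_prop)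
  exact ((h3.sub continuousAt_const).const_smul (a n)).continuousWithinAt

theorem tendsto_smul_sub_of_tendstoUniformlyOn (hΘo : IsOpen Θo) (hτ : ContDiffOn ℝ 2 τ Θo)
    (hθ : Tendsto θ atTop (𝓝 θs)) {a : ℕ → ℝ} {c : Vec db → Vec dt} {B : Set (Vec db)}
    (hc : TendstoUniformlyOn (fun n β => a n • (τ ((θ n).1, β) - τ (θ n))) c atTop B)
    {β : Vec db} (hβ : (θs.1, β) ∈ Θo) (hB : β ∈ B) {α : Type*} {l : Filter α} {ν : α → ℕ}
    (hν : Tendsto ν l atTop) {b : α → Vec db} (hb : Tendsto b l (𝓝 β)) (hbB : ∀ᶠ i in l, b i ∈ B) :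
    Tendsto (fun i => a (ν i) • (τ ((θ (ν i)).1, b i) - τ (θ (ν i)))) l (𝓝 (c β)) := by
  have h1 : Tendsto (fun i => c (b i)) l (𝓝 (c β)) :=
    (continuousWithinAt_of_tendstoUniformlyOn hΘo hτ hθ hc hβ hB).tendsto.comp
      (tendsto_nhdsWithin_iff.2 ⟨hb, hbB⟩)
  refine h1.congr_uniformity ?_
  intro u hu
  rw [mem_map]
  filter_upwards [hν.eventually (hc u hu), hbB] with i hi hiB using hi _ hiB

end Geometry

/-! ### Set limits of images -/

section Image

variable {X Y : Type*} [TopologicalSpace X] {f : ℕ → Y → X} {S : Set Y} {B : Set X}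

theorem PKLimit.mem_of_tendsto_image (h : PKLimit (fun n => f n '' S) B) {x : X} {α : Type*}
    {l : Filter α} [l.NeBot] {ν : α → ℕ} {t : α → Y} (hν : Tendsto ν l atTop)
    (ht : ∀ᶠ i in l, t i ∈ S) (hx : Tendsto (fun i => f (ν i) (t i)) l (𝓝 x)) : x ∈ B :=
  h.mem_of_tendsto hν hx (ht.mono fun i hi => mem_image_of_mem (f (ν i)) hi)

variable [Nonempty Y]

theorem pkLimit_image
    (hu : ∀ (x : X) (U : Ultrafilter (ℕ × X)) (t : ℕ × X → Y), Tendsto Prod.fst U.1 atTop →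
      (∀ᶠ p in U.1, t p ∈ S) → Tendsto (fun p => f p.1 (t p)) U.1 (𝓝 x) → x ∈ B)
    (hl : ∀ x ∈ B, ∃ t : ℕ → Y, (∀ᶠ n in atTop, t n ∈ S) ∧
      Tendsto (fun n => f n (t n)) atTop (𝓝 x)) : PKLimit (fun n => f n '' S) B where
  upper x hx := by
    obtain ⟨U, hν, hz, hmem⟩ := exists_ultrafilter_of_frequently
      (A := fun n => f n '' S) hx
    have hex : ∀ p : ℕ × X, p.2 ∈ f p.1 '' S → ∃ t ∈ S, f p.1 t = p.2 := fun p hp => hp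
    choose! t htS ht using hex
    exact hu x U t hν (hmem.mono fun p hp => htS p hp)
      (hz.congr' (hmem.mono fun p hp => (ht p hp).symm))
  lower x hx := by
    obtain ⟨t, ht, hlim⟩ := hl x hx
    exact ⟨_, ht.mono fun n hn => mem_image_of_mem (f n) hn, hlim⟩

theorem PKLimit.exists_seq_image (h : PKLimit (fun n => f n '' S) B) {x : X} (hx : x ∈ B) :
    ∃ t : ℕ → Y, (∀ᶠ n in atTop, t n ∈ S) ∧ Tendsto (fun n => f n (t n)) atTop (𝓝 x) := by
  obtain ⟨u, hu, hlim⟩ := h.lower x hx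
  have hex : ∀ n : ℕ, u n ∈ f n '' S → ∃ t ∈ S, f n t = u n := fun n hn => hn
  choose! t htS ht using hex
  exact ⟨t, hu.mono fun n hn => htS n hn, hlim.congr' (hu.mono fun n hn => (ht n hn).symm)⟩

end Image

/-! ### Weak identification -/

section Weak

variable {dp db dt k₁ k₂ : ℕ} {Θ Θo : Set (Vec dp × Vec db)} {τ : Vec dp × Vec db → Vec dt}
  {θ : ℕ → Vec dp × Vec db} {θs : Vec dp × Vec db}

/-- The parameter space with only `π` localized: `{(√n (π - π₀), β) | (π, β) ∈ S}`. -/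
def weakLocal (n : ℕ) (θ₀ : Vec dp × Vec db) (S : Set (Vec dp × Vec db)) :
    Set (Vec dp × Vec db) :=
  (fun t => (√(n : ℝ) • (t.1 - θ₀.1), t.2)) '' S

/-- The limit `D_1(π_*, β) p + g(β)` of the reduced-form local parameters under weak
identification, as a function of `(p, β)`. -/
noncomputable def weakMap (τ : Vec dp × Vec db → Vec dt) (πs : Vec dp) (c : Vec db → Vec dt)
    (x : Vec dp × Vec db) : Vec₂ dp dt :=
  stack x.1 (mulVecL (dτπ τ (πs, x.2)) x.1 + c x.2)

theorem tendsto_link_weak (hΘo : IsOpen Θo) (hΘ : Θ ⊆ Θo) (hτ : ContDiffOn ℝ 2 τ Θo)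
    (hθ : Tendsto θ atTop (𝓝 θs)) {c : Vec db → Vec dt} (hc : WeakSeq Θ τ θ θs c)
    {α : Type*} {l : Filter α} {ν : α → ℕ} (hν : Tendsto ν l atTop) {t : α → Vec dp × Vec db}
    (ht : ∀ᶠ i in l, t i ∈ Θ) {p : Vec dp} {β : Vec db} (hβΘ : (θs.1, β) ∈ Θ)
    (hp : Tendsto (fun i => √(ν i : ℝ) • ((t i).1 - (θ (ν i)).1)) l (𝓝 p))
    (hβ : Tendsto (fun i => (t i).2) l (𝓝 β)) :
    Tendsto (fun i => √(ν i : ℝ) • (link τ (t i) - link τ (θ (ν i)))) l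
      (𝓝 (weakMap τ θs.1 c (p, β))) := by
  obtain ⟨S, hS, hunif⟩ := hc
  have hπ : Tendsto (fun i => (t i).1) l (𝓝 θs.1) := tendsto_of_smul_sub
    (tendsto_sqrt_natCast hν) hp ((continuous_fst.tendsto θs).comp (hθ.comp hν))
  have h1 := tendsto_sqrt_smul_sub_left (hasStrictFDerivAt_of_contDiffOn hΘo hτ (hΘ hβΘ))
    hθ hν hp hβ
  have h2 := tendsto_smul_sub_of_tendstoUniformlyOn hΘo hτ hθ hunif (hΘ hβΘ)
    (⟨θs.1, mem_of_mem_nhds hS, hβΘ⟩ : β ∈ crossSec Θ S) hν hβ (by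
      filter_upwards [ht, hπ.eventually hS] with i hi hiS
      exact ⟨(t i).1, hiS, hi⟩)
  refine (tendsto_stack hp (h1.add h2)).congr fun i => ?_
  rw [smul_link_sub_link, ← smul_add, sub_add_sub_cancel]

/-- Under weak identification the limit of the reduced-form local parameter space is determined by
the limit of `{(√n (π - π_n), β)}`. -/
theorem pkLimit_linkLocal_weak (hΘo : IsOpen Θo) (hΘ : Θ ⊆ Θo) (hτ : ContDiffOn ℝ 2 τ Θo)
    (hθ : Tendsto θ atTop (𝓝 θs)) (hPS : RegularParamSpace Θ θs.1) {c : Vec db → Vec dt}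
    (hc : WeakSeq Θ τ θ θs c) {S Λ : Set (Vec dp × Vec db)} (hS : S ⊆ Θ)
    (hΛ : PKLimit (fun n => weakLocal n (θ n) S) Λ) :
    PKLimit (fun n => linkLocal n τ (θ n) S) (weakMap τ θs.1 c '' Λ) := by
  have hπ : Tendsto (fun n => (θ n).1) atTop (𝓝 θs.1) := (continuous_fst.tendsto θs).comp hθ
  refine pkLimit_image ?_ ?_
  · intro x U t hν ht hx
    have htΘ : ∀ᶠ p in U.1, t p ∈ Θ := ht.mono fun p hp => hS hp
    have hp : Tendsto (fun p => √(p.1 : ℝ) • ((t p).1 - (θ p.1).1)) U.1 (𝓝 (fstV x)) := by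
      refine ((continuous_fstV.tendsto x).comp hx).congr fun p => ?_
      simp only [Function.comp_apply, smul_link_sub_link, fstV_stack]
    obtain ⟨β, hβΘ, hβ⟩ := exists_tendsto_snd hPS U htΘ
      (tendsto_of_smul_sub (tendsto_sqrt_natCast hν) hp (hπ.comp hν))
    exact ⟨(fstV x, β), hΛ.mem_of_tendsto_image hν ht (hp.prodMk_nhds hβ),
      tendsto_nhds_unique (tendsto_link_weak hΘo hΘ hτ hθ hc hν htΘ hβΘ hp hβ) hx⟩
  · rintro _ ⟨⟨p, β⟩, hpβ, rfl⟩
    obtain ⟨t, ht, hlim⟩ := hΛ.exists_seq_image hpβ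
    have htΘ : ∀ᶠ n in atTop, t n ∈ Θ := ht.mono fun p hp => hS hp
    have hp : Tendsto (fun n : ℕ => √(n : ℝ) • ((t n).1 - (θ n).1)) atTop (𝓝 p) :=
      (continuous_fst.tendsto _).comp hlim
    have hβ : Tendsto (fun n => (t n).2) atTop (𝓝 β) := (continuous_snd.tendsto _).comp hlim
    have hβΘ : (θs.1, β) ∈ Θ := hPS.1.mem_of_tendsto
      ((tendsto_of_smul_sub (tendsto_sqrt_natCast tendsto_id) hp hπ).prodMk_nhds hβ) htΘ
    exact ⟨t, ht, tendsto_link_weak hΘo hΘ hτ hθ hc tendsto_id htΘ hβΘ hp hβ⟩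

theorem tendsto_add_inv_sqrt_smul {x : ℕ → Vec dp} {x₀ p : Vec dp} (hx : Tendsto x atTop (𝓝 x₀)) :
    Tendsto (fun n : ℕ => x n + (√(n : ℝ))⁻¹ • p) atTop (𝓝 x₀) := by
  have h1 := (tendsto_inv_atTop_zero.comp (tendsto_sqrt_natCast tendsto_id)).smul_const p
  rw [zero_smul] at h1
  simpa only [add_zero, Function.comp_def, id] using hx.add h1

/-- The unrestricted parameter space: `π` varies freely at scale `n^{-1/2}`, and `β` over `B_*`. -/
theorem pkLimit_weakLocal (hθ : Tendsto θ atTop (𝓝 θs)) (hPS : RegularParamSpace Θ θs.1) :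
    PKLimit (fun n => weakLocal n (θ n) Θ) (univ ×ˢ crossSec Θ {θs.1}) := by
  have hπ : Tendsto (fun n => (θ n).1) atTop (𝓝 θs.1) := (continuous_fst.tendsto θs).comp hθ
  refine pkLimit_image ?_ ?_
  · rintro ⟨p, β⟩ U t hν ht hx
    have hp : Tendsto (fun p => √(p.1 : ℝ) • ((t p).1 - (θ p.1).1)) U.1 (𝓝 p) :=
      (continuous_fst.tendsto _).comp hx
    have hβ : Tendsto (fun p => (t p).2) U.1 (𝓝 β) := (continuous_snd.tendsto _).comp hx
    exact ⟨mem_univ _, mem_crossSec_singleton.2 (hPS.1.mem_of_tendsto ((tendsto_of_smul_sub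
      (tendsto_sqrt_natCast hν) hp (hπ.comp hν)).prodMk_nhds hβ) ht)⟩
  · rintro ⟨p, β⟩ ⟨-, hβ⟩
    obtain ⟨-, -, M, hM, W, hW, hLip⟩ := hPS
    have hπ' := tendsto_add_inv_sqrt_smul (p := p) hπ
    obtain ⟨b, hbB, hb⟩ := exists_tendsto_of_hausdorffEDist (B := fun π => crossSec Θ {π}) hπ' (by
      filter_upwards [hπ'.eventually hW] with n hn
      exact hLip _ (mem_of_mem_nhds hW) _ hn) hβ
    refine ⟨fun n => ((θ n).1 + (√(n : ℝ))⁻¹ • p, b n),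
      hbB.mono fun n hn => mem_crossSec_singleton.1 hn, Tendsto.prodMk_nhds ?_ hb⟩
    refine tendsto_const_nhds.congr' ?_
    filter_upwards [eventually_gt_atTop 0] with n hn
    have : √(n : ℝ) ≠ 0 := (Real.sqrt_pos.2 (by exact_mod_cast hn)).ne'
    simp [smul_smul, this]

/-- The restricted parameter space when the null hypothesis fixes `β`. -/
theorem pkLimit_weakLocal_of_nullPinsBeta {r₁ : Vec dp → Vec k₁} {r₂ : Vec db → Vec k₂}
    (hθr : ∀ n, θ n ∈ restricted Θ r₁ r₂) (hpin : NullPinsBeta Θ r₂ θs.2) {Ψr : Set (Vec₂ dp db)}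
    (hΨ : PKLimit (fun n => localSet n √(n : ℝ) (θ n) (restricted Θ r₁ r₂)) Ψr) :
    PKLimit (fun n => weakLocal n (θ n) (restricted Θ r₁ r₂))
      ((fun ψ => (fstV ψ, θs.2)) '' Ψr) := by
  have hsnd : ∀ t ∈ restricted Θ r₁ r₂, t.2 = θs.2 := fun t ht =>
    hpin t.2 ⟨t.1, mem_univ _, ht.1⟩ ht.2.2
  refine pkLimit_image ?_ ?_
  · rintro ⟨p, β⟩ U t hν ht hx
    have hp : Tendsto (fun p => √(p.1 : ℝ) • ((t p).1 - (θ p.1).1)) U.1 (𝓝 p) :=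
      (continuous_fst.tendsto _).comp hx
    have hβ : Tendsto (fun p => (t p).2) U.1 (𝓝 β) := (continuous_snd.tendsto _).comp hx
    have hβs : β = θs.2 := tendsto_nhds_unique (hβ.congr' (ht.mono fun i hi => hsnd _ hi))
      tendsto_const_nhds
    refine ⟨stack p 0, hΨ.mem_of_tendsto_image hν ht ?_, by simp only [fstV_stack, hβs]⟩
    refine (tendsto_stack hp tendsto_const_nhds).congr' (ht.mono fun i hi => ?_)
    simp only [hsnd _ hi, hsnd _ (hθr i.1), sub_self, smul_zero]
  · rintro _ ⟨ψ, hψ, rfl⟩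
    obtain ⟨t, ht, hlim⟩ := hΨ.exists_seq_image hψ
    refine ⟨t, ht, Tendsto.prodMk_nhds ((continuous_fstV.tendsto ψ).comp hlim) ?_⟩
    exact tendsto_const_nhds.congr' (ht.mono fun n hn => (hsnd _ hn).symm)

end Weak

/-! ### Weak identification under the null hypothesis -/

section Null

variable {dp db dt k₁ k₂ : ℕ} {Θ Θo : Set (Vec dp × Vec db)}
  {θ : ℕ → Vec dp × Vec db} {θs : Vec dp × Vec db}

/-- Correction to a zero: if `f` has a surjective strict derivative at `a`, `x n → a` and
`c n • f (x n) → 0`, then `f` has zeros `z n` with `c n • (z n - x n) → 0`. -/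
theorem exists_zero_of_surjective {E F : Type*} [NormedAddCommGroup E] [NormedSpace ℝ E]
    [CompleteSpace E] [NormedAddCommGroup F] [NormedSpace ℝ F] [CompleteSpace F] {f : E → F}
    {L : E →L[ℝ] F} {a : E} (hf : HasStrictFDerivAt f L a) (ha : f a = 0)
    (hL : LinearMap.range (L : E →ₗ[ℝ] F) = ⊤) {x : ℕ → E} (hx : Tendsto x atTop (𝓝 a)) {c : ℕ → ℝ}
    (hc : Tendsto (fun n => c n • f (x n)) atTop (𝓝 0)) :
    ∃ z : ℕ → E, (∀ᶠ n in atTop, f (z n) = 0) ∧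
      Tendsto (fun n => c n • (z n - x n)) atTop (𝓝 0) := by
  obtain ⟨R, hR⟩ := L.exists_nonlinearRightInverse_of_surjective hL
  have hR' : (0 : ℝ) < (R.nnnorm : ℝ)⁻¹ := inv_pos.2 hR
  obtain ⟨s, hs, happ⟩ := hf.approximates_deriv_on_nhds (c := R.nnnorm⁻¹ / 2)
    (Or.inr (half_pos (inv_pos.2 hR)))
  set k : ℝ := (R.nnnorm : ℝ)⁻¹ - ((R.nnnorm⁻¹ / 2 : NNReal) : ℝ) with hk
  have hk0 : 0 < k := by
    rw [hk]; push_cast; linarith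
  obtain ⟨ρ, hρ, hball⟩ := Metric.nhds_basis_closedBall.mem_iff.1 hs
  have hfx : Tendsto (fun n => ‖f (x n)‖ / k) atTop (𝓝 0) := by
    have := ((hf.continuousAt.tendsto.comp hx).norm).div_const k
    simpa [ha] using this
  have hex : ∀ n, Metric.closedBall (x n) (‖f (x n)‖ / k) ⊆ s →
      ∃ z, f z = 0 ∧ ‖z - x n‖ ≤ ‖f (x n)‖ / k := fun n hn => by
    obtain ⟨z, hz, hz0⟩ := happ.surjOn_closedBall_of_nonlinearRightInverse R
      (by positivity : 0 ≤ ‖f (x n)‖ / k) hn (show (0 : F) ∈ _ by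
        rw [Metric.mem_closedBall, dist_zero_left, ← hk, mul_div_cancel₀ _ hk0.ne'])
    exact ⟨z, hz0, by rwa [Metric.mem_closedBall, dist_eq_norm] at hz⟩
  choose! z hz0 hz using hex
  have hev : ∀ᶠ n in atTop, Metric.closedBall (x n) (‖f (x n)‖ / k) ⊆ s := by
    filter_upwards [hx.eventually (Metric.closedBall_mem_nhds a (half_pos hρ)),
      hfx.eventually (eventually_le_nhds (half_pos hρ))] with n h1 h2
    refine (Metric.closedBall_subset_closedBall' ?_).trans hball
    have h1' : dist (x n) a ≤ ρ / 2 := h1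
    linarith
  refine ⟨z, hev.mono hz0, squeeze_zero_norm' (hev.mono fun n hn => ?_)
    (by simpa using hc.norm.div_const k)⟩
  rw [norm_smul, norm_smul, mul_div_assoc]
  gcongr
  exact hz n hn

/-- The restricted parameter space under weak identification: the restriction on `π` linearizes to
`R₁ p = 0`, and `β` varies over `B^r_*`. -/
theorem pkLimit_weakLocal_restricted (hΘo : IsOpen Θo) (hΘ : Θ ⊆ Θo)
    (hθ : Tendsto θ atTop (𝓝 θs)) (hcl : IsClosed Θ)
    {r₁ : Vec dp → Vec k₁} {r₂ : Vec db → Vec k₂} (hθr : ∀ n, θ n ∈ restricted Θ r₁ r₂)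
    (hreg : RegularRestriction Θo r₁ r₂ θs.1) (hLN : LipschitzNullCrossSec Θ r₁ r₂ θs.1) :
    PKLimit (fun n => weakLocal n (θ n) (restricted Θ r₁ r₂))
      ({p | jacobian r₁ θs.1 *ᵥ p.ofLp = 0} ×ˢ crossSecR Θ r₂ θs.1) := by
  obtain ⟨hsmooth, hrank⟩ := hreg
  have hπ : Tendsto (fun n => (θ n).1) atTop (𝓝 θs.1) := (continuous_fst.tendsto θs).comp hθ
  have hθs : θs ∈ Θ := hcl.mem_of_tendsto hθ (Eventually.of_forall fun n => (hθr n).1)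
  have hr₁ : HasStrictFDerivAt r₁ (mulVecL (jacobian r₁ θs.1)) θs.1 := by
    have h1 : ContDiffAt ℝ 1 (fun θ : Vec dp × Vec db => r₁ θ.1) (θs.1, θs.2) :=
      contDiffAt_fst.comp _ (hsmooth.contDiffAt (hΘo.mem_nhds (hΘ hθs)))
    have h2 : ContDiffAt ℝ 1 r₁ θs.1 :=
      ContDiffAt.comp (g := fun θ : Vec dp × Vec db => r₁ θ.1) (f := fun p => (p, θs.2)) θs.1 h1
        (contDiffAt_id.prodMk contDiffAt_const)
    rw [mulVecL_jacobian]
    exact h2.hasStrictFDerivAt one_ne_zero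
  have hr₂ : ∀ β, (θs.1, β) ∈ Θ → ContinuousAt r₂ β := fun β hβ => by
    have h1 : ContinuousAt (fun θ : Vec dp × Vec db => r₂ θ.2) (θs.1, β) :=
      continuousAt_snd.comp (hsmooth.continuousOn.continuousAt (hΘo.mem_nhds (hΘ hβ)))
    exact ContinuousAt.comp (g := fun θ : Vec dp × Vec db => r₂ θ.2) (f := fun b => (θs.1, b)) h1
      (by fun_prop)
  have hr₁s : r₁ θs.1 = 0 := tendsto_nhds_unique (hr₁.continuousAt.tendsto.comp hπ)
    (tendsto_const_nhds.congr fun n => (hθr n).2.1.symm)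
  refine pkLimit_image ?_ ?_
  · rintro ⟨p, β⟩ U t hν ht hx
    have hp : Tendsto (fun p => √(p.1 : ℝ) • ((t p).1 - (θ p.1).1)) U.1 (𝓝 p) :=
      (continuous_fst.tendsto _).comp hx
    have hβ : Tendsto (fun p => (t p).2) U.1 (𝓝 β) := (continuous_snd.tendsto _).comp hx
    have hπt := tendsto_of_smul_sub (tendsto_sqrt_natCast hν) hp (hπ.comp hν)
    have hβΘ : (θs.1, β) ∈ Θ :=
      hcl.mem_of_tendsto (hπt.prodMk_nhds hβ) (ht.mono fun i hi => hi.1)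
    refine ⟨?_, mem_crossSec_singleton.2 hβΘ, ?_⟩
    · have h1 := tendsto_smul_sub_of_hasStrictFDerivAt hr₁ hπt (hπ.comp hν) hp
      have h2 : mulVecL (jacobian r₁ θs.1) p = 0 := by
        refine tendsto_nhds_unique h1 (tendsto_const_nhds.congr' (ht.mono fun i hi => ?_))
        simp only [Function.comp_apply, hi.2.1, (hθr i.1).2.1, sub_self, smul_zero]
      rw [mulVecL_apply] at h2
      exact WithLp.toLp_injective 2 h2
    · exact tendsto_nhds_unique ((hr₂ β hβΘ).tendsto.comp hβ)
        (tendsto_const_nhds.congr' (ht.mono fun i hi => hi.2.2.symm))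
  · rintro ⟨p, β⟩ ⟨hp, hβ⟩
    have hp0 : mulVecL (jacobian r₁ θs.1) p = 0 := by
      rw [mulVecL_apply, show jacobian r₁ θs.1 *ᵥ p.ofLp = 0 from hp]; rfl
    have hx := tendsto_add_inv_sqrt_smul (p := p) hπ
    have hxp : Tendsto (fun n : ℕ => √(n : ℝ) • ((θ n).1 + (√(n : ℝ))⁻¹ • p - (θ n).1)) atTop
        (𝓝 p) := by
      refine tendsto_const_nhds.congr' ?_
      filter_upwards [eventually_gt_atTop 0] with n hn
      have : √(n : ℝ) ≠ 0 := (Real.sqrt_pos.2 (by exact_mod_cast hn)).ne'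
      simp [smul_smul, this]
    have hrx : Tendsto (fun n : ℕ => √(n : ℝ) • r₁ ((θ n).1 + (√(n : ℝ))⁻¹ • p)) atTop (𝓝 0) := by
      have h1 := tendsto_smul_sub_of_hasStrictFDerivAt hr₁ hx hπ hxp
      rw [hp0] at h1
      refine h1.congr fun n => ?_
      rw [(hθr n).2.1, sub_zero]
    have hsurj : LinearMap.range (mulVecL (jacobian r₁ θs.1) : Vec dp →ₗ[ℝ] Vec k₁) = ⊤ := by
      refine LinearMap.range_eq_top.2 fun w => ?_
      obtain ⟨v, hv⟩ := surjective_mulVec_of_rank (A := jacobian r₁ θs.1) (by simpa using hrank)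
        w.ofLp
      refine ⟨WithLp.toLp 2 v, ?_⟩
      change mulVecL (jacobian r₁ θs.1) (WithLp.toLp 2 v) = w
      rw [mulVecL_apply]
      exact congrArg (WithLp.toLp 2) hv
    obtain ⟨z, hz0, hz⟩ := exists_zero_of_surjective hr₁ hr₁s hsurj hx hrx
    have hzp : Tendsto (fun n : ℕ => √(n : ℝ) • (z n - (θ n).1)) atTop (𝓝 p) := by
      have := hz.add hxp
      rw [zero_add] at this
      refine this.congr fun n => ?_
      rw [← smul_add, sub_add_sub_cancel]
    have hzπ := tendsto_of_smul_sub (tendsto_sqrt_natCast tendsto_id) hzp hπ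
    obtain ⟨M, hM, W, hW, hLip⟩ := hLN
    obtain ⟨b, hbB, hb⟩ := exists_tendsto_of_hausdorffEDist (B := crossSecR Θ r₂) hzπ (by
      filter_upwards [hzπ.eventually hW, hz0] with n hn hn0
      exact hLip _ (mem_of_mem_nhds hW) _ hn hr₁s hn0) hβ
    refine ⟨fun n => (z n, b n), ?_, hzp.prodMk_nhds hb⟩
    filter_upwards [hz0, hbB] with n hn1 hn2
    exact ⟨mem_crossSec_singleton.1 hn2.1, hn1, hn2.2⟩

end Null

/-! ### Strong and semi-strong identification -/

section Strong

variable {dp db dt : ℕ} {Θ Θo : Set (Vec dp × Vec db)} {τ : Vec dp × Vec db → Vec dt}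
  {θ : ℕ → Vec dp × Vec db} {θs : Vec dp × Vec db}

theorem mulVecL_matD (C : Matrix (Fin dt) (Fin db) ℝ) (p : Vec dp) (b : Vec db) :
    mulVecL (matD τ θs C) (stack p b) = stack p (mulVecL (dτπ τ θs) p + mulVecL C b) := by
  ext i
  rcases i with i | i <;>
    simp [matD, stack, Matrix.fromBlocks_mulVec, Function.comp_def, Matrix.one_mulVec]

/-- The common content of strong and semi-strong identification with weakness `a n`: the rescaled
link function `a n • τ(π_n, ·)` has the strict derivative `C`, of full column rank, at `β_*`
uniformly in `n`, and `β_*` is the only limit of `β`s for which `√n (δ(π, β) - δ_n)` converges. -/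
structure IdentifiedSeq (Θ : Set (Vec dp × Vec db)) (τ : Vec dp × Vec db → Vec dt)
    (θ : ℕ → Vec dp × Vec db) (θs : Vec dp × Vec db) (a : ℕ → ℝ) (C : Matrix (Fin dt) (Fin db) ℝ) :
    Prop where
  pos : ∀ n, 0 < a n
  tendsto_div : Tendsto (fun n : ℕ => a n / √(n : ℝ)) atTop (𝓝 0)
  rank_eq : C.rank = db
  isLittleO : (fun x : ℕ × Vec db => a x.1 • (τ ((θ x.1).1, x.2) - τ (θ x.1)) -
    mulVecL C (x.2 - (θ x.1).2)) =o[atTop ×ˢ 𝓝 θs.2] fun x => x.2 - (θ x.1).2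
  eq_of_tendsto : ∀ (U : Ultrafilter (ℕ × Vec₂ dp dt)) (t : ℕ × Vec₂ dp dt → Vec dp × Vec db)
    (β : Vec db) (p : Vec dp) (w : Vec dt), Tendsto Prod.fst U.1 atTop → (∀ᶠ i in U.1, t i ∈ Θ) →
    (θs.1, β) ∈ Θ → Tendsto (fun i => (t i).2) U.1 (𝓝 β) →
    Tendsto (fun i => √(i.1 : ℝ) • ((t i).1 - (θ i.1).1)) U.1 (𝓝 p) →
    Tendsto (fun i => √(i.1 : ℝ) • (τ (t i) - τ (θ i.1))) U.1 (𝓝 w) → β = θs.2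

variable {a : ℕ → ℝ} {C : Matrix (Fin dt) (Fin db) ℝ}

theorem IdentifiedSeq.tendsto_atTop (h : IdentifiedSeq Θ τ θ θs a C) :
    Tendsto (fun n : ℕ => √(n : ℝ) / a n) atTop atTop := by
  have h1 : Tendsto (fun n : ℕ => a n / √(n : ℝ)) atTop (𝓝[>] 0) := by
    refine tendsto_nhdsWithin_iff.2 ⟨h.tendsto_div, ?_⟩
    filter_upwards [eventually_gt_atTop 0] with n hn
    exact div_pos (h.pos n) (Real.sqrt_pos.2 (by exact_mod_cast hn))
  refine (tendsto_inv_nhdsGT_zero.comp h1).congr fun n => ?_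
  simp

theorem IdentifiedSeq.tendsto_link (hΘo : IsOpen Θo) (hτ : ContDiffOn ℝ 2 τ Θo) (hθs : θs ∈ Θo)
    (hθ : Tendsto θ atTop (𝓝 θs)) (h : IdentifiedSeq Θ τ θ θs a C)
    {α : Type*} {l : Filter α} {ν : α → ℕ} (hν : Tendsto ν l atTop) {t : α → Vec dp × Vec db}
    {p : Vec dp} {b : Vec db}
    (hp : Tendsto (fun i => √(ν i : ℝ) • ((t i).1 - (θ (ν i)).1)) l (𝓝 p))
    (hb : Tendsto (fun i => (√(ν i : ℝ) / a (ν i)) • ((t i).2 - (θ (ν i)).2)) l (𝓝 b)) :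
    Tendsto (fun i => √(ν i : ℝ) • (link τ (t i) - link τ (θ (ν i)))) l
      (𝓝 (mulVecL (matD τ θs C) (stack p b))) := by
  have hβ : Tendsto (fun i => (t i).2) l (𝓝 θs.2) := tendsto_of_smul_sub
    (h.tendsto_atTop.comp hν) hb ((continuous_snd.tendsto θs).comp (hθ.comp hν))
  have h1 := tendsto_sqrt_smul_sub_left (β := θs.2)
    (hasStrictFDerivAt_of_contDiffOn hΘo hτ hθs) hθ hν hp hβ
  have h2 := h.isLittleO.comp_tendsto (hν.prodMk hβ)
  have h3 := (Asymptotics.isLittleO_one_iff ℝ).1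
    (((Asymptotics.isBigO_refl (fun i => √(ν i : ℝ) / a (ν i)) l).smul_isLittleO h2).trans_isBigO
      (hb.isBigO_one ℝ))
  have h4 := h3.add (((mulVecL C).continuous.tendsto b).comp hb)
  rw [zero_add] at h4
  rw [mulVecL_matD]
  refine (tendsto_stack hp (h1.add h4)).congr fun i => ?_
  rw [smul_link_sub_link]
  congr 1
  have ha : a (ν i) ≠ 0 := (h.pos _).ne'
  simp only [Function.comp_apply, smul_sub, map_smul, map_sub, smul_smul, div_mul_cancel₀ _ ha]
  abel

/-- Under strong and semi-strong identification the limit of the reduced-form local parameter space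
is the image under `D` of the limit of the local parameter space. -/
theorem IdentifiedSeq.pkLimit_linkLocal (hΘo : IsOpen Θo) (hτ : ContDiffOn ℝ 2 τ Θo)
    (hθs : θs ∈ Θo) (hθ : Tendsto θ atTop (𝓝 θs)) (hPS : RegularParamSpace Θ θs.1)
    (h : IdentifiedSeq Θ τ θ θs a C) {S : Set (Vec dp × Vec db)} (hS : S ⊆ Θ) {Ψ : Set (Vec₂ dp db)}
    (hΨ : PKLimit (fun n => localSet n (a n) (θ n) S) Ψ) :
    PKLimit (fun n => linkLocal n τ (θ n) S) (mulVecL (matD τ θs C) '' Ψ) := by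
  have hπ : Tendsto (fun n => (θ n).1) atTop (𝓝 θs.1) := (continuous_fst.tendsto θs).comp hθ
  refine pkLimit_image ?_ ?_
  · intro x U t hν ht hx
    have htΘ : ∀ᶠ p in U.1, t p ∈ Θ := ht.mono fun p hp => hS hp
    have hp : Tendsto (fun p => √(p.1 : ℝ) • ((t p).1 - (θ p.1).1)) U.1 (𝓝 (fstV x)) := by
      refine ((continuous_fstV.tendsto x).comp hx).congr fun p => ?_
      simp only [Function.comp_apply, smul_link_sub_link, fstV_stack]
    have hw : Tendsto (fun p => √(p.1 : ℝ) • (τ (t p) - τ (θ p.1))) U.1 (𝓝 (sndV x)) := by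
      refine ((continuous_sndV.tendsto x).comp hx).congr fun p => ?_
      simp only [Function.comp_apply, smul_link_sub_link, sndV_stack]
    obtain ⟨β, hβΘ, hβ⟩ := exists_tendsto_snd hPS U htΘ
      (tendsto_of_smul_sub (tendsto_sqrt_natCast hν) hp (hπ.comp hν))
    obtain rfl := h.eq_of_tendsto U t β _ _ hν htΘ hβΘ hβ hp hw
    have h1 := hw.sub (tendsto_sqrt_smul_sub_left (β := θs.2)
      (hasStrictFDerivAt_of_contDiffOn hΘo hτ hθs) hθ hν hp hβ)
    obtain ⟨r, hr, hC⟩ := exists_mulVecL_lower (A := C) (by simpa using h.rank_eq)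
    have h2 := (h.isLittleO.comp_tendsto (hν.prodMk hβ)).bound (half_pos hr)
    -- `C` is bounded below, so convergence of `√n τ` bounds `√n (β - β_n) / a_n`.
    have hbd : ∀ᶠ p in U.1, ‖(√(p.1 : ℝ) / a p.1) • ((t p).2 - (θ p.1).2)‖ ≤
        2 / r * (‖sndV x - mulVecL (dτπ τ (θs.1, θs.2)) (fstV x)‖ + 1) := by
      filter_upwards [h2, h1.norm.eventually (eventually_le_nhds (lt_add_one _))] with p hp2 hp1
      have ha := h.pos p.1
      have h3 : r / 2 * ‖(t p).2 - (θ p.1).2‖ ≤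
          ‖a p.1 • (τ ((θ p.1).1, (t p).2) - τ (θ p.1))‖ := by
        have h4 := hC ((t p).2 - (θ p.1).2)
        have h5 := norm_sub_norm_le (mulVecL C ((t p).2 - (θ p.1).2))
          (a p.1 • (τ ((θ p.1).1, (t p).2) - τ (θ p.1)))
        rw [norm_sub_rev] at h5
        simp only [Function.comp_apply] at hp2
        linarith
      have h6 : √(p.1 : ℝ) • (τ (t p) - τ (θ p.1)) -
          √(p.1 : ℝ) • (τ (t p) - τ ((θ p.1).1, (t p).2)) =
          (√(p.1 : ℝ) / a p.1) • (a p.1 • (τ ((θ p.1).1, (t p).2) - τ (θ p.1))) := by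
        rw [smul_smul, div_mul_cancel₀ _ ha.ne', ← smul_sub, sub_sub_sub_cancel_left]
      rw [h6, norm_smul] at hp1
      rw [norm_smul, div_mul_eq_mul_div, le_div_iff₀ hr]
      have h7 : ‖√(p.1 : ℝ) / a p.1‖ * (r / 2 * ‖(t p).2 - (θ p.1).2‖) ≤
          ‖√(p.1 : ℝ) / a p.1‖ * ‖a p.1 • (τ ((θ p.1).1, (t p).2) - τ (θ p.1))‖ := by gcongr
      linarith
    obtain ⟨b, hb⟩ := exists_tendsto_of_norm_le U hbd
    exact ⟨stack (fstV x) b, hΨ.mem_of_tendsto_image hν ht (tendsto_stack hp hb),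
      tendsto_nhds_unique (h.tendsto_link hΘo hτ hθs hθ hν hp hb) hx⟩
  · rintro _ ⟨ψ, hψ, rfl⟩
    obtain ⟨t, ht, hlim⟩ := hΨ.exists_seq_image hψ
    refine ⟨t, ht, ?_⟩
    have h1 := h.tendsto_link hΘo hτ hθs hθ (ν := fun n => n) tendsto_id (t := t)
      (p := fstV ψ) (b := sndV ψ)
      ((continuous_fstV.tendsto ψ).comp hlim) ((continuous_sndV.tendsto ψ).comp hlim)
    rwa [stack_fstV_sndV] at h1

theorem StrongSeq.identifiedSeq (hΘo : IsOpen Θo) (hΘ : Θ ⊆ Θo) (hτ : ContDiffOn ℝ 2 τ Θo)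
    (hθs : θs ∈ Θ) (hθ : Tendsto θ atTop (𝓝 θs)) (h : StrongSeq Θ τ θs) :
    IdentifiedSeq Θ τ θ θs (fun _ => 1) (dτβ τ θs) where
  pos _ := one_pos
  tendsto_div := by
    simpa only [one_div, Function.comp_def, id] using
      tendsto_inv_atTop_zero.comp (tendsto_sqrt_natCast tendsto_id)
  rank_eq := h.2
  isLittleO := by
    have hd := hasStrictFDerivAt_of_contDiffOn hΘo hτ (hΘ hθs)
    have hθ' : Tendsto (fun x : ℕ × Vec db => θ x.1) (atTop ×ˢ 𝓝 θs.2) (𝓝 θs) :=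
      hθ.comp tendsto_fst
    have hx : Tendsto (fun x : ℕ × Vec db => ((θ x.1).1, x.2)) (atTop ×ˢ 𝓝 θs.2) (𝓝 θs) :=
      ((continuous_fst.tendsto θs).comp hθ').prodMk_nhds tendsto_snd
    refine ((hd.isLittleO.comp_tendsto (hx.prodMk_nhds hθ')).congr_left fun x => ?_).trans_isBigO
      (Asymptotics.isBigO_of_le _ fun x => ?_)
    · have hsub : ((θ x.1).1, x.2) - θ x.1 = (0, x.2 - (θ x.1).2) := by ext <;> simp
      simp only [Function.comp_apply]
      rw [hsub, mulVecL_dτβ hd.hasFDerivAt.differentiableAt, one_smul]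
    · have hsub : ((θ x.1).1, x.2) - θ x.1 = (0, x.2 - (θ x.1).2) := by ext <;> simp
      simp only [Function.comp_apply]
      rw [hsub]
      simp [Prod.norm_def]
  eq_of_tendsto U t β p w hν ht hβΘ hβ hp hw := by
    have hθν : Tendsto (fun i : ℕ × Vec₂ dp dt => θ i.1) U.1 (𝓝 θs) := hθ.comp hν
    have hcont : ∀ {z}, z ∈ Θ → ContinuousAt τ z := fun hz =>
      hτ.continuousOn.continuousAt (hΘo.mem_nhds (hΘ hz))
    have hπ := tendsto_of_smul_sub (tendsto_sqrt_natCast hν) hp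
      ((continuous_fst.tendsto θs).comp hθν)
    refine h.1 β (mem_crossSec_singleton.2 hβΘ) ?_
    exact tendsto_nhds_unique ((hcont hβΘ).tendsto.comp (hπ.prodMk_nhds hβ))
      (tendsto_of_smul_sub (tendsto_sqrt_natCast hν) hw ((hcont hθs).tendsto.comp hθν))

/-- Uniform convergence of the rescaled derivatives near `β_*` makes them converge jointly in `n`
and `β`: the limit inherits continuity at `β_*`. -/
theorem tendsto_smul_dτβ (hΘo : IsOpen Θo) (hτ : ContDiffOn ℝ 2 τ Θo)
    (hθs : θs ∈ Θo) (hθ : Tendsto θ atTop (𝓝 θs)) {a : ℕ → ℝ}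
    {Cf : Vec db → Matrix (Fin dt) (Fin db) ℝ} {U : Set (Vec db)} (hU : U ∈ 𝓝 θs.2)
    (hunif : TendstoUniformlyOn (fun n β => a n • dτβ τ ((θ n).1, β)) Cf atTop U) :
    Tendsto (fun x : ℕ × Vec db => a x.1 • dτβ τ ((θ x.1).1, x.2)) (atTop ×ˢ 𝓝 θs.2)
      (𝓝 (Cf θs.2)) := by
  have hπ : Tendsto (fun n => ((θ n).1, θs.2)) atTop (𝓝 θs) :=
    ((continuous_fst.tendsto θs).comp hθ).prodMk_nhds tendsto_const_nhds
  have hcont : ∀ z ∈ Θo, ContinuousAt (dτβ τ) z := fun z hz => by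
    have h1 : ContDiffAt ℝ 2 τ z := hτ.contDiffAt (hΘo.mem_nhds hz)
    have h2 : ContinuousAt (fderiv ℝ τ) z :=
      (h1.fderiv_right (m := 1) (by norm_num)).continuousAt
    refine continuousAt_pi.2 fun i => continuousAt_pi.2 fun j => ?_
    have h3 : ContinuousAt (fun z => (fderiv ℝ τ z (0, EuclideanSpace.single j 1)) i) z :=
      (EuclideanSpace.proj (𝕜 := ℝ) i).continuous.continuousAt.comp
        (h2.clm_apply continuousAt_const)
    refine h3.congr ?_
    filter_upwards [hΘo.mem_nhds hz] with y hy
    rw [← mulVecL_dτβ ((hτ.contDiffAt (hΘo.mem_nhds hy)).differentiableAt (by norm_num))]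
    simp
  have hCf : ContinuousWithinAt Cf U θs.2 := by
    refine continuousWithinAt_of_locally_uniform_approx_of_continuousWithinAt
      (mem_of_mem_nhds hU) fun u hu => ?_
    obtain ⟨n, hn, hno⟩ := ((hunif u hu).and (hπ.eventually (hΘo.mem_nhds hθs))).exists
    refine ⟨U, self_mem_nhdsWithin, _, ?_, hn⟩
    have h3 : ContinuousAt (fun b => dτβ τ ((θ n).1, b)) θs.2 :=
      ContinuousAt.comp (g := dτβ τ) (hcont _ hno) (by fun_prop)
    exact (h3.const_smul (a n)).continuousWithinAt
  have h1 : Tendsto (fun x : ℕ × Vec db => Cf x.2) (atTop ×ˢ 𝓝 θs.2) (𝓝 (Cf θs.2)) :=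
    (hCf.continuousAt hU).tendsto.comp tendsto_snd
  refine h1.congr_uniformity ?_
  intro u hu
  rw [mem_map]
  filter_upwards [(hunif u hu).prod_mk (eventually_mem_set.2 hU)] with x hx using hx.1 _ hx.2

theorem SemiStrongSeq.identifiedSeq (hΘo : IsOpen Θo) (hΘ : Θ ⊆ Θo) (hτ : ContDiffOn ℝ 2 τ Θo)
    (hθs : θs ∈ Θ) (hθ : Tendsto θ atTop (𝓝 θs)) {a : ℕ → ℝ}
    {Cf : Vec db → Matrix (Fin dt) (Fin db) ℝ} (h : SemiStrongSeq Θ τ θ θs a Cf) :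
    IdentifiedSeq Θ τ θ θs a (Cf θs.2) := by
  obtain ⟨hpos, -, hdiv, ⟨c, S, hS, hc, hc0⟩, ⟨U, hU, hunif⟩, hrank⟩ := h
  refine ⟨hpos, hdiv, hrank, ?_, ?_⟩
  · have hlim := (continuous_mulVecL.tendsto _).comp
      (tendsto_smul_dτβ hΘo hτ (hΘ hθs) hθ hU hunif)
    refine Asymptotics.isLittleO_iff.2 fun ε hε => ?_
    have hθ' : Tendsto (fun x : ℕ × Vec db => ((θ x.1).1, x.2)) (atTop ×ˢ 𝓝 θs.2) (𝓝 θs) :=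
      ((continuous_fst.tendsto θs).comp (hθ.comp tendsto_fst)).prodMk_nhds tendsto_snd
    have hev := (hlim.eventually (Metric.ball_mem_nhds _ hε)).and
      (hθ'.eventually (hΘo.mem_nhds (hΘ hθs)))
    obtain ⟨pa, hpa, pb, hpb, hab⟩ := eventually_prod_iff.1 hev
    obtain ⟨r, hr, hball⟩ := Metric.mem_nhds_iff.1 hpb
    have hβ : Tendsto (fun n => (θ n).2) atTop (𝓝 θs.2) := (continuous_snd.tendsto θs).comp hθ
    filter_upwards [(hpa.and (hβ.eventually (Metric.ball_mem_nhds _ hr))).prod_mk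
      (eventually_mem_set.2 (Metric.ball_mem_nhds θs.2 hr))] with ⟨n, b⟩ ⟨⟨hn, hnβ⟩, hb⟩
    -- The mean value inequality on a ball around `β_*`.
    have hmvt := (convex_ball θs.2 r).norm_image_sub_le_of_norm_hasFDerivWithin_le
      (f := fun b => a n • τ ((θ n).1, b) - mulVecL (Cf θs.2) b)
      (f' := fun b => mulVecL (a n • dτβ τ ((θ n).1, b)) - mulVecL (Cf θs.2)) (C := ε)
      (fun z hz => by
        have hz' := (hab hn (hball hz)).2
        have h1 := hasFDerivAt_dτβ (τ := τ) (θ := ((θ n).1, z))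
          ((hτ.contDiffAt (hΘo.mem_nhds hz')).differentiableAt (by norm_num))
        have h2 : mulVecL (a n • dτβ τ ((θ n).1, z)) = a n • mulVecL (dτβ τ ((θ n).1, z)) := by
          ext v i; simp [Matrix.smul_mulVec]
        rw [h2]
        exact ((h1.const_smul (a n)).sub (mulVecL (Cf θs.2)).hasFDerivAt).hasFDerivWithinAt)
      (fun z hz => by
        have h1 := (hab hn (hball hz)).1
        rw [dist_eq_norm] at h1
        exact h1.le) hnβ hb
    refine le_trans (le_of_eq ?_) hmvt
    congr 1
    simp only [smul_sub, map_sub]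
    abel
  · intro V t β p w hν ht hβΘ hβ hp hw
    have hθν : Tendsto (fun i : ℕ × Vec₂ dp dt => θ i.1) V.1 (𝓝 θs) := hθ.comp hν
    have hπ := tendsto_of_smul_sub (tendsto_sqrt_natCast hν) hp
      ((continuous_fst.tendsto θs).comp hθν)
    have hβS : β ∈ crossSec Θ S := ⟨θs.1, mem_of_mem_nhds hS, hβΘ⟩
    refine hc0 β hβS ?_
    have h1 := tendsto_smul_sub_of_tendstoUniformlyOn hΘo hτ hθ hc (hΘ hβΘ) hβS hν hβ (by
      filter_upwards [ht, hπ.eventually hS] with i hi hiS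
      exact ⟨(t i).1, hiS, hi⟩)
    -- `a_n (τ(π_n, β) - τ(θ_n))` is `a_n / √n → 0` times a convergent sequence.
    have h2 := hw.sub (tendsto_sqrt_smul_sub_left (hasStrictFDerivAt_of_contDiffOn hΘo hτ (hΘ hβΘ))
      hθ hν hp hβ)
    have h3 := (hdiv.comp hν).smul h2
    rw [zero_smul] at h3
    refine tendsto_nhds_unique h1 (h3.congr' ?_)
    filter_upwards [hν.eventually (eventually_gt_atTop 0)] with i hi
    have hs : √(i.1 : ℝ) ≠ 0 := (Real.sqrt_pos.2 (by exact_mod_cast hi)).ne'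
    simp only [Function.comp_apply]
    rw [← smul_sub, sub_sub_sub_cancel_left, smul_smul, div_mul_cancel₀ _ hs]

end Strong

/-! ### Minimizing the limit objectives -/

section Algebra

theorem transpose_eq_of_posDef {ι : Type*} {A : Matrix ι ι ℝ} (hA : A.PosDef) : Aᵀ = A := by
  rw [← Matrix.conjTranspose_eq_transpose_of_trivial]; exact hA.isHermitian

variable {ι κ μ : Type*} [Fintype ι] [Fintype κ] [Fintype μ]

theorem quad_add {A : Matrix ι ι ℝ} (hA : Aᵀ = A) (v w : ι → ℝ) :
    quad A (v + w) = quad A v + 2 * (w ⬝ᵥ A *ᵥ v) + quad A w := by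
  have h : v ⬝ᵥ A *ᵥ w = w ⬝ᵥ A *ᵥ v := by
    rw [Matrix.dotProduct_mulVec, ← Matrix.mulVec_transpose, hA, dotProduct_comm]
  simp only [quad, Matrix.mulVec_add, add_dotProduct, dotProduct_add, h]
  ring

theorem quad_nonneg {A : Matrix ι ι ℝ} (hA : A.PosDef) (v : ι → ℝ) : 0 ≤ quad A v := by
  simpa [quad] using hA.posSemidef.dotProduct_mulVec_nonneg v

theorem quad_mulVec (H : Matrix ι ι ℝ) (D : Matrix ι κ ℝ) (v : κ → ℝ) :
    quad H (D *ᵥ v) = quad (matJ H D) v := by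
  simp only [quad, matJ, ← Matrix.mulVec_mulVec]
  rw [Matrix.dotProduct_mulVec v, Matrix.vecMul_transpose]

theorem posDef_matJ {H : Matrix ι ι ℝ} (hH : H.PosDef) {D : Matrix ι κ ℝ}
    (hD : Function.Injective D.mulVec) : (matJ H D).PosDef := by
  have := hH.conjTranspose_mul_mul_same hD
  rwa [Matrix.conjTranspose_eq_transpose_of_trivial] at this

variable [DecidableEq κ]

/-- Completing the square in `2 y'(D v + g) + (D v + g)'H(D v + g)`, as a function of `v`. -/
theorem qobj_eq_of_posDef {H : Matrix ι ι ℝ} (hH : H.PosDef) {D : Matrix ι κ ℝ}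
    (hD : Function.Injective D.mulVec) (y g : ι → ℝ) (v : κ → ℝ) :
    2 * (y ⬝ᵥ (D *ᵥ v + g)) + quad H (D *ᵥ v + g) =
      2 * (quad H g / 2 + y ⬝ᵥ g - quad (matJ H D) (vecZ H D (y + H *ᵥ g)) / 2) +
        quad (matJ H D) (vecZ H D (y + H *ᵥ g) - v) := by
  have hJ := posDef_matJ hH hD
  have hHt := transpose_eq_of_posDef hH
  set z := vecZ H D (y + H *ᵥ g) with hz
  have hJz : matJ H D *ᵥ z = -(Dᵀ *ᵥ (y + H *ᵥ g)) := by
    rw [hz, vecZ, Matrix.mulVec_neg, Matrix.mulVec_mulVec,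
      Matrix.mul_nonsing_inv _ ((Matrix.isUnit_iff_isUnit_det _).1 hJ.isUnit), Matrix.one_mulVec]
  have hvz : v ⬝ᵥ matJ H D *ᵥ z = -((y + H *ᵥ g) ⬝ᵥ D *ᵥ v) := by
    rw [hJz, dotProduct_neg, Matrix.dotProduct_mulVec, Matrix.vecMul_transpose, dotProduct_comm]
  have hneg : quad (matJ H D) (-v) = quad (matJ H D) v := by
    simp [quad, Matrix.mulVec_neg]
  have hgH : H *ᵥ g ⬝ᵥ D *ᵥ v = g ⬝ᵥ H *ᵥ (D *ᵥ v) := by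
    rw [Matrix.dotProduct_mulVec g, ← Matrix.mulVec_transpose, hHt]
  rw [sub_eq_add_neg z v, quad_add (transpose_eq_of_posDef hJ), quad_add hHt, quad_mulVec, hneg,
    neg_dotProduct, hvz, add_dotProduct, dotProduct_add, hgH]
  ring

variable [DecidableEq μ]

/-- The minimum of `v'J v` subject to `R v = w` is `w'(R J⁻¹ R')⁻¹ w`. -/
theorem quad_inv_le {J : Matrix κ κ ℝ} (hJ : J.PosDef) {R : Matrix μ κ ℝ}
    (hR : R.rank = Fintype.card μ) (w : μ → ℝ) :
    (∃ v, R *ᵥ v = w ∧ quad J v = quad (R * J⁻¹ * Rᵀ)⁻¹ w) ∧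
      ∀ v, R *ᵥ v = w → quad (R * J⁻¹ * Rᵀ)⁻¹ w ≤ quad J v := by
  have hinj : Function.Injective Rᵀ.mulVec :=
    injective_mulVec_of_rank (by rw [Matrix.rank_transpose, hR])
  have hM : (R * J⁻¹ * Rᵀ).PosDef := by
    simpa [matJ] using posDef_matJ hJ.inv hinj
  have hdJ := (Matrix.isUnit_iff_isUnit_det _).1 hJ.isUnit
  have hdM := (Matrix.isUnit_iff_isUnit_det _).1 hM.isUnit
  set M := R * J⁻¹ * Rᵀ with hMdef
  -- The minimizer and its Lagrange multiplier `M⁻¹ w`.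
  set v₀ := J⁻¹ *ᵥ (Rᵀ *ᵥ (M⁻¹ *ᵥ w)) with hv₀
  have hRv : R *ᵥ v₀ = w := by
    rw [hv₀, Matrix.mulVec_mulVec, Matrix.mulVec_mulVec, Matrix.mulVec_mulVec, ← hMdef,
      Matrix.mul_nonsing_inv _ hdM, Matrix.one_mulVec]
  have hJv : J *ᵥ v₀ = Rᵀ *ᵥ (M⁻¹ *ᵥ w) := by
    rw [hv₀, Matrix.mulVec_mulVec, Matrix.mul_nonsing_inv _ hdJ, Matrix.one_mulVec]
  have hdot : ∀ u, u ⬝ᵥ J *ᵥ v₀ = (R *ᵥ u) ⬝ᵥ (M⁻¹ *ᵥ w) := fun u => by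
    rw [hJv, Matrix.dotProduct_mulVec, Matrix.vecMul_transpose]
  have hval : quad J v₀ = quad M⁻¹ w := by
    rw [quad, hdot, hRv, quad]
  refine ⟨⟨v₀, hRv, hval⟩, fun v hv => ?_⟩
  have h1 := quad_add (transpose_eq_of_posDef hJ) v₀ (v - v₀)
  rw [add_sub_cancel, hdot, Matrix.mulVec_sub, hv, hRv, sub_self, zero_dotProduct, hval] at h1
  linarith [quad_nonneg hJ (v - v₀)]

end Algebra

theorem sInf_image_add_const {α : Type*} {A : Set α} {f : α → ℝ} (hA : A.Nonempty)
    (hf : BddBelow (f '' A)) (k : ℝ) : sInf ((fun x => f x + k) '' A) = sInf (f '' A) + k := by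
  have := (OrderIso.addRight k).map_csInf' (hA.image f) hf
  rw [image_image] at this
  exact this.symm

section Limits

variable {dp db dt k₁ : ℕ} {H : Matrix (Fin dp ⊕ Fin dt) (Fin dp ⊕ Fin dt) ℝ}
  {τ : Vec dp × Vec db → Vec dt}

theorem injective_matD {θs : Vec dp × Vec db} {C : Matrix (Fin dt) (Fin db) ℝ} (hC : C.rank = db) :
    Function.Injective (matD τ θs C).mulVec := by
  intro v w hvw
  have h1 : mulVecL (matD τ θs C) (stack (fstV (WithLp.toLp 2 v)) (sndV (WithLp.toLp 2 v))) =
      mulVecL (matD τ θs C) (stack (fstV (WithLp.toLp 2 w)) (sndV (WithLp.toLp 2 w))) := by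
    simp only [stack_fstV_sndV, mulVecL_apply]
    exact congrArg (WithLp.toLp 2) hvw
  rw [mulVecL_matD, mulVecL_matD] at h1
  have h2 := congrArg fstV h1
  have h3 := congrArg sndV h1
  rw [fstV_stack, fstV_stack] at h2
  rw [sndV_stack, sndV_stack, h2, add_right_inj, mulVecL_apply, mulVecL_apply] at h3
  have h4 := injective_mulVec_of_rank (A := C) (by simpa using hC) (WithLp.toLp_injective 2 h3)
  have h5 : (WithLp.toLp 2 v : Vec₂ dp db) = WithLp.toLp 2 w := by
    rw [← stack_fstV_sndV (WithLp.toLp 2 v), ← stack_fstV_sndV (WithLp.toLp 2 w), h2,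
      WithLp.ofLp_injective 2 h4]
  exact WithLp.toLp_injective 2 h5

theorem injective_matD₁ (t : Vec dp × Vec db) : Function.Injective (matD₁ τ t).mulVec := by
  intro v w hvw
  funext i
  simpa [matD₁, Matrix.fromRows_mulVec] using congrFun hvw (Sum.inl i)

/-- The limit under strong and semi-strong identification. -/
theorem infObj_matD_sub (hH : H.PosDef) {θs : Vec dp × Vec db} {C : Matrix (Fin dt) (Fin db) ℝ}
    (hC : C.rank = db) {Ψ Ψr : Set (Vec₂ dp db)} (hΨ : Ψ.Nonempty) (hΨr : Ψr.Nonempty)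
    (y : Vec₂ dp dt) :
    infObj H (mulVecL (matD τ θs C) '' Ψr) y - infObj H (mulVecL (matD τ θs C) '' Ψ) y =
      qlrS H (matD τ θs C) Ψ Ψr y := by
  have hD := injective_matD (τ := τ) (θs := θs) hC
  have key : ∀ A : Set (Vec₂ dp db), A.Nonempty → infObj H (mulVecL (matD τ θs C) '' A) y =
      sInf ((fun ψ : Vec₂ dp db =>
        quad (matJ H (matD τ θs C)) (vecZ H (matD τ θs C) y.ofLp - ψ.ofLp)) '' A) +
      -quad (matJ H (matD τ θs C)) (vecZ H (matD τ θs C) y.ofLp) := fun A hA => by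
    rw [← sInf_image_add_const hA, infObj, image_image]
    · congr 2
      funext ψ
      have h1 := qobj_eq_of_posDef hH hD y.ofLp 0 ψ.ofLp
      simp only [add_zero, Matrix.mulVec_zero, dotProduct_zero] at h1
      rw [qobj, mulVecL_apply, h1]
      simp [quad]
      ring
    · refine ⟨0, ?_⟩
      rintro _ ⟨ψ, -, rfl⟩
      exact quad_nonneg (posDef_matJ hH hD) _
  rw [key Ψr hΨr, key Ψ hΨ, qlrS]
  ring

theorem qobj_weakMap (hH : H.PosDef) (πs : Vec dp) (c : Vec db → Vec dt) (y : Vec₂ dp dt)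
    (p : Vec dp) (β : Vec db) : qobj H y (weakMap τ πs c (p, β)) =
      2 * qW τ πs H c y β + quad (matJ₁₁ τ πs H β) (vecZ₁ τ πs H c y β - p.ofLp) := by
  have h1 : (weakMap τ πs c (p, β)).ofLp = matD₁ τ (πs, β) *ᵥ p.ofLp + vecG c β := by
    funext i
    rcases i with i | i <;> simp [weakMap, stack, matD₁, vecG, Matrix.fromRows_mulVec]
  rw [qobj, h1, qobj_eq_of_posDef hH (injective_matD₁ _)]
  rfl

/-- Concentrating out the freely varying local parameter `p` gives `q̃^W`. -/
theorem infObj_weakMap (hH : H.PosDef) (πs : Vec dp) (c : Vec db → Vec dt) (B : Set (Vec db))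
    (y : Vec₂ dp dt) : infObj H (weakMap τ πs c '' (univ ×ˢ B)) y =
      sInf ((fun β => 2 * qW τ πs H c y β) '' B) := by
  refine csInf_eq_csInf_of_forall_exists_le ?_ ?_
  · rintro _ ⟨_, ⟨⟨p, β⟩, ⟨-, hβ⟩, rfl⟩, rfl⟩
    refine ⟨_, mem_image_of_mem _ hβ, ?_⟩
    rw [qobj_weakMap hH]
    exact le_add_of_nonneg_right (quad_nonneg (posDef_matJ hH (injective_matD₁ _)) _)
  · rintro _ ⟨β, hβ, rfl⟩
    refine ⟨_, mem_image_of_mem _ (mem_image_of_mem (weakMap τ πs c)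
      (show (WithLp.toLp 2 (vecZ₁ τ πs H c y β), β) ∈ univ ×ˢ B from ⟨mem_univ _, hβ⟩)), ?_⟩
    rw [qobj_weakMap hH]
    simp [quad]

/-- Concentrating out the local parameter `p` subject to `R₁ p = 0` gives `q̃^{W,r}`. -/
theorem infObj_weakMap_restricted (hH : H.PosDef) (πs : Vec dp) (c : Vec db → Vec dt)
    (B : Set (Vec db)) {R₁ : Matrix (Fin k₁) (Fin dp) ℝ} (hR : R₁.rank = k₁) (y : Vec₂ dp dt) :
    infObj H (weakMap τ πs c '' ({p | R₁ *ᵥ p.ofLp = 0} ×ˢ B)) y =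
      sInf ((fun β => 2 * qWr τ πs H c R₁ y β) '' B) := by
  have hmin := fun β => quad_inv_le (R := R₁) (posDef_matJ hH (injective_matD₁ (τ := τ) (πs, β)))
    (by simpa using hR) (R₁ *ᵥ vecZ₁ τ πs H c y β)
  refine csInf_eq_csInf_of_forall_exists_le ?_ ?_
  · rintro _ ⟨_, ⟨⟨p, β⟩, ⟨hp, hβ⟩, rfl⟩, rfl⟩
    refine ⟨_, mem_image_of_mem _ hβ, ?_⟩
    have hp : R₁ *ᵥ p.ofLp = 0 := hp
    have h1 := (hmin β).2 (vecZ₁ τ πs H c y β - p.ofLp) (by rw [Matrix.mulVec_sub, hp, sub_zero])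
    rw [qobj_weakMap hH]
    simp only [qWr, matJ₁₁] at h1 ⊢
    linarith
  · rintro _ ⟨β, hβ, rfl⟩
    obtain ⟨v, hv, hval⟩ := (hmin β).1
    refine ⟨_, mem_image_of_mem _ (mem_image_of_mem (weakMap τ πs c)
      (show (WithLp.toLp 2 (vecZ₁ τ πs H c y β - v), β) ∈ {p : Vec dp | R₁ *ᵥ p.ofLp = 0} ×ˢ B from
        ⟨?_, hβ⟩)), ?_⟩
    · change R₁ *ᵥ (vecZ₁ τ πs H c y β - v) = 0
      rw [Matrix.mulVec_sub, hv, sub_self]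
    · rw [qobj_weakMap hH]
      simp only [qWr, matJ₁₁, sub_sub_cancel] at hval ⊢
      linarith

/-- The restricted limit objective when the null hypothesis fixes `β = β_*`, where `c` vanishes. -/
theorem infObj_weakMap_pinned (hH : H.PosDef) (θs : Vec dp × Vec db) {c : Vec db → Vec dt}
    (hc : c θs.2 = 0) {Ψr : Set (Vec₂ dp db)} (hΨr : Ψr.Nonempty) (y : Vec₂ dp dt) :
    infObj H (weakMap τ θs.1 c '' ((fun ψ => (fstV ψ, θs.2)) '' Ψr)) y =
      sInf ((fun ψ : Vec₂ dp db => quad (matJ₁₁ τ θs.1 H θs.2)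
        (vecZ₁ τ θs.1 H c y θs.2 - fun i => ψ (Sum.inl i))) '' Ψr) -
      quad (matJ₁₁ τ θs.1 H θs.2) (vecZ₁ τ θs.1 H c y θs.2) := by
  rw [sub_eq_add_neg, ← sInf_image_add_const hΨr, infObj, image_image, image_image]
  · congr 2
    funext ψ
    have hG : (vecG c θs.2 : Fin dp ⊕ Fin dt → ℝ) = 0 := by
      funext i
      rcases i with i | i <;> simp [vecG, hc]
    have hq : 2 * qW τ θs.1 H c y θs.2 =
        -quad (matJ₁₁ τ θs.1 H θs.2) (vecZ₁ τ θs.1 H c y θs.2) := by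
      rw [qW, hG, dotProduct_zero]
      simp only [quad, Matrix.mulVec_zero, dotProduct_zero]
      ring
    rw [qobj_weakMap hH, hq, add_comm]
    rfl
  · refine ⟨0, ?_⟩
    rintro _ ⟨ψ, -, rfl⟩
    exact quad_nonneg (posDef_matJ hH (injective_matD₁ _)) _

end Limits

/-! ### The limit distribution of the QLR statistic -/

section Main

variable {dp db dt k₁ k₂ : ℕ} {Ω : ℕ → Type*} [∀ n, MeasurableSpace (Ω n)]
  {P : ∀ n, Measure (Ω n)} [∀ n, IsProbabilityMeasure (P n)] {Ω' : Type*} [MeasurableSpace Ω']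
  {P' : Measure Ω'} [IsProbabilityMeasure P']

/-- If the reduced-form local parameter spaces converge, to `L` and under the null hypothesis to
`Lr`, then the QLR statistic converges in distribution to the difference of the minimal values of
the limit objective over `Lr` and `L`. -/
theorem tendstoInDistribution_qlr {Θ Θo Θr : Set (Vec dp × Vec db)} (hΘo : IsOpen Θo)
    (hΘ : Θ ⊆ Θo) {τ : Vec dp × Vec db → Vec dt} (hτ : ContDiffOn ℝ 2 τ Θo)
    {θ : ℕ → Vec dp × Vec db} {θs : Vec dp × Vec db} (hθs : θs ∈ Θo)
    (hθ : Tendsto θ atTop (𝓝 θs)) {Q : ∀ n, Ω n → Vec dp × Vec db → ℝ}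
    {T : ∀ n, Ω n → Vec₂ dp dt → ℝ}
    (hQT : ReducedFormObjective P Θo τ θ Q T) (hT : ReducedFormIdentified P Θo τ θs T)
    (hQE : QuadraticExpansion P Θo τ θ T) {Y : Ω' → Vec₂ dp dt}
    {V H : Matrix (Fin dp ⊕ Fin dt) (Fin dp ⊕ Fin dt) ℝ}
    (hLim : ReducedFormLimits P τ θ T P' Y V H) (hΘr : Θr ⊆ Θ) (hθr : ∀ n, θ n ∈ Θr)
    (hmeas : ∀ n, AEMeasurable (fun ω => qlr n (Q n ω) Θ Θr) (P n)) {L Lr : Set (Vec₂ dp dt)}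
    (hL : PKLimit (fun n => linkLocal n τ (θ n) Θ) L)
    (hLr : PKLimit (fun n => linkLocal n τ (θ n) Θr) Lr) {g : Vec₂ dp dt → ℝ}
    (hg : ∀ y, infObj H Lr y - infObj H L y = g y) :
    TendstoInDistribution (fun n ω => qlr n (Q n ω) Θ Θr) atTop (fun ω => g (Y ω)) P P' := by
  obtain ⟨-, -, hY, hPD, hH⟩ := hLim
  have hδ : Tendsto (fun n => link τ (θ n)) atTop (𝓝 (link τ θs)) :=
    tendsto_stack ((continuous_fst.tendsto θs).comp hθ)
      ((hτ.continuousOn.continuousAt (hΘo.mem_nhds hθs)).tendsto.comp hθ)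
  refine tendstoInDistribution_of_tendsto_prod hY
    (G := fun n y => infObj H (linkLocal n τ (θ n) Θr) y - infObj H (linkLocal n τ (θ n) Θ) y)
    (fun y => ?_) hmeas fun K ε hε =>
      tendsto_measure_qlr_approx hQT hT hQE hPD hH hΘ hΘr hθr hθs hδ K hε
  rw [← hg y]
  exact (tendsto_infObj hPD hLr (fun n => zero_mem_linkLocal n τ (hθr n)) y).sub
    (tendsto_infObj hPD hL (fun n => zero_mem_linkLocal n τ (hΘr (hθr n))) y)

theorem LocalLimit.pkLimit {S : Set (Vec dp × Vec db)} {θ : ℕ → Vec dp × Vec db} {a : ℕ → ℝ}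
    {Ψ : Set (Vec₂ dp db)} (h : LocalLimit S θ a Ψ) :
    PKLimit (fun n => localSet n (a n) (θ n) S) Ψ :=
  h.2.pkLimit h.1

theorem LocalLimit.nonempty {S : Set (Vec dp × Vec db)} {θ : ℕ → Vec dp × Vec db} {a : ℕ → ℝ}
    {Ψ : Set (Vec₂ dp db)} (h : LocalLimit S θ a Ψ) (hθ : ∀ n, θ n ∈ S) : Ψ.Nonempty := by
  refine ⟨stack 0 0, h.pkLimit.mem_of_tendsto_image (l := atTop) (ν := fun n => n) (t := θ)
    tendsto_id (Eventually.of_forall hθ) (tendsto_const_nhds.congr fun n => ?_)⟩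
  simp

/-- If the null hypothesis fixes `β`, then `β_n = β_*`, so that `c(β_*) = 0`. -/
theorem WeakSeq.apply_eq_zero {Θ : Set (Vec dp × Vec db)} {τ : Vec dp × Vec db → Vec dt}
    {θ : ℕ → Vec dp × Vec db} {θs : Vec dp × Vec db} {c : Vec db → Vec dt}
    (hc : WeakSeq Θ τ θ θs c) (hθs : θs ∈ Θ) (hβ : ∀ n, (θ n).2 = θs.2) : c θs.2 = 0 := by
  obtain ⟨S, hS, hunif⟩ := hc
  refine tendsto_nhds_unique (hunif.tendsto_at (⟨θs.1, mem_of_mem_nhds hS, hθs⟩ :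
    θs.2 ∈ crossSec Θ S)) (tendsto_const_nhds.congr fun n => ?_)
  rw [← hβ n, sub_self, smul_zero]

end Main

end QLRLimit

/-! ### The four limits -/

theorem theorem2 {dp db dt k₁ k₂ : ℕ}
    -- the laws of the samples of size `n` under the true parameters
    {Ω : ℕ → Type*} [∀ n, MeasurableSpace (Ω n)] (P : ∀ n, Measure (Ω n))
    [∀ n, IsProbabilityMeasure (P n)]
    -- the probability space of the Gaussian limit
    {Ω' : Type*} [MeasurableSpace Ω'] (P' : Measure Ω') [IsProbabilityMeasure P']
    -- the parameter space, an open set around it, and the link function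
    (Θ Θo : Set (Vec dp × Vec db)) (hΘo : IsOpen Θo) (hΘ : Θ ⊆ Θo)
    (τ : Vec dp × Vec db → Vec dt) (hτ : ContDiffOn ℝ 2 τ Θo)
    -- the true parameters
    (θ : ℕ → Vec dp × Vec db) (θs : Vec dp × Vec db) (hθΘ : ∀ n, θ n ∈ Θ)
    (hθ : Tendsto θ atTop (𝓝 θs))
    -- the objective function
    (Q : ∀ n, Ω n → Vec dp × Vec db → ℝ) (T : ∀ n, Ω n → Vec₂ dp dt → ℝ)
    (hQT : ReducedFormObjective P Θo τ θ Q T)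
    (hT : ReducedFormIdentified P Θo τ θs T)
    (hPS : RegularParamSpace Θ θs.1)
    (hQE : QuadraticExpansion P Θo τ θ T)
    (Y : Ω' → Vec₂ dp dt) (V H : Matrix (Fin dp ⊕ Fin dt) (Fin dp ⊕ Fin dt) ℝ)
    (hLim : ReducedFormLimits P τ θ T P' Y V H)
    -- the null hypothesis
    (r₁ : Vec dp → Vec k₁) (r₂ : Vec db → Vec k₂)
    (hr : ∀ n, r₁ (θ n).1 = 0 ∧ r₂ (θ n).2 = 0)
    -- the QLR statistic is a random variable
    (hmeas : ∀ n, AEMeasurable (fun ω => qlr n (Q n ω) Θ (restricted Θ r₁ r₂)) (P n)) :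
    -- (a) strong sequences
    (∀ Ψ Ψr : Set (Vec₂ dp db), StrongSeq Θ τ θs →
      LocalLimit Θ θ (fun _ => 1) Ψ →
      LocalLimit (restricted Θ r₁ r₂) θ (fun _ => 1) Ψr →
      TendstoInDistribution (fun n ω => qlr n (Q n ω) Θ (restricted Θ r₁ r₂)) atTop
        (fun ω => qlrS H (matD τ θs (dτβ τ θs)) Ψ Ψr (Y ω)) P P') ∧
    -- (b) semi-strong sequences
    (∀ (a : ℕ → ℝ) (Cf : Vec db → Matrix (Fin dt) (Fin db) ℝ) (Ψ Ψr : Set (Vec₂ dp db)),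
      SemiStrongSeq Θ τ θ θs a Cf →
      LocalLimit Θ θ a Ψ →
      RegularRestriction Θo r₁ r₂ θs.1 →
      (NullPinsBeta Θ r₂ θs.2 ∨ LipschitzNullCrossSec Θ r₁ r₂ θs.1) →
      LocalLimit (restricted Θ r₁ r₂) θ a Ψr →
      TendstoInDistribution (fun n ω => qlr n (Q n ω) Θ (restricted Θ r₁ r₂)) atTop
        (fun ω => qlrS H (matD τ θs (Cf θs.2)) Ψ Ψr (Y ω)) P P') ∧
    -- (c) weak sequences, no weakly identified nuisance parameters under the null
    (∀ (c : Vec db → Vec dt) (Ψr : Set (Vec₂ dp db)), WeakSeq Θ τ θ θs c →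
      NullPinsBeta Θ r₂ θs.2 →
      LocalLimit (restricted Θ r₁ r₂) θ (fun n => √(n : ℝ)) Ψr →
      TendstoInDistribution (fun n ω => qlr n (Q n ω) Θ (restricted Θ r₁ r₂)) atTop
        (fun ω => qlrW1 Θ τ θs H c Ψr (Y ω)) P P') ∧
    -- (d) weak sequences, weakly identified nuisance parameters under the null
    (∀ c : Vec db → Vec dt, WeakSeq Θ τ θ θs c →
      RegularRestriction Θo r₁ r₂ θs.1 →
      LipschitzNullCrossSec Θ r₁ r₂ θs.1 →
      TendstoInDistribution (fun n ω => qlr n (Q n ω) Θ (restricted Θ r₁ r₂)) atTop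
        (fun ω => qlrW2 Θ τ θs.1 H c r₁ r₂ (Y ω)) P P') := by
  have hθr : ∀ n, θ n ∈ restricted Θ r₁ r₂ := fun n => ⟨hθΘ n, hr n⟩
  have hΘr : restricted Θ r₁ r₂ ⊆ Θ := fun t ht => ht.1
  have hθs : θs ∈ Θ := hPS.1.mem_of_tendsto hθ (Eventually.of_forall hθΘ)
  have hPD : H.PosDef := hLim.2.2.2.1
  have main := fun (L Lr : Set (Vec₂ dp dt)) =>
    tendstoInDistribution_qlr (L := L) (Lr := Lr) hΘo hΘ hτ (hΘ hθs) hθ hQT hT hQE hLim hΘr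
      hθr hmeas
  have hweak : ∀ c, WeakSeq Θ τ θ θs c → PKLimit (fun n => linkLocal n τ (θ n) Θ)
      (weakMap τ θs.1 c '' (univ ×ˢ crossSec Θ {θs.1})) := fun c hc =>
    pkLimit_linkLocal_weak hΘo hΘ hτ hθ hPS hc Subset.rfl (pkLimit_weakLocal hθ hPS)
  refine ⟨fun Ψ Ψr hS hΨ hΨr => ?_, fun a Cf Ψ Ψr hS hΨ _ _ hΨr => ?_, fun c Ψr hc hpin hΨr => ?_,
    fun c hc hreg hLN => ?_⟩
  · have hI := hS.identifiedSeq hΘo hΘ hτ hθs hθ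
    exact main _ _ (hI.pkLimit_linkLocal hΘo hτ (hΘ hθs) hθ hPS Subset.rfl hΨ.pkLimit)
      (hI.pkLimit_linkLocal hΘo hτ (hΘ hθs) hθ hPS hΘr hΨr.pkLimit)
      (infObj_matD_sub hPD hI.rank_eq (hΨ.nonempty hθΘ) (hΨr.nonempty hθr))
  · have hI := hS.identifiedSeq hΘo hΘ hτ hθs hθ
    exact main _ _ (hI.pkLimit_linkLocal hΘo hτ (hΘ hθs) hθ hPS Subset.rfl hΨ.pkLimit)
      (hI.pkLimit_linkLocal hΘo hτ (hΘ hθs) hθ hPS hΘr hΨr.pkLimit)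
      (infObj_matD_sub hPD hI.rank_eq (hΨ.nonempty hθΘ) (hΨr.nonempty hθr))
  · have hβ : ∀ n, (θ n).2 = θs.2 := fun n => hpin _ ⟨(θ n).1, mem_univ _, hθΘ n⟩ (hr n).2
    refine main _ _ (hweak c hc) (pkLimit_linkLocal_weak hΘo hΘ hτ hθ hPS hc hΘr
      (pkLimit_weakLocal_of_nullPinsBeta hθr hpin hΨr.pkLimit)) fun y => ?_
    rw [infObj_weakMap hPD, infObj_weakMap_pinned hPD θs (hc.apply_eq_zero hθs hβ)
      (hΨr.nonempty hθr), qlrW1]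
  · refine main _ _ (hweak c hc) (pkLimit_linkLocal_weak hΘo hΘ hτ hθ hPS hc hΘr
      (pkLimit_weakLocal_restricted hΘo hΘ hθ hPS.1 hθr hreg hLN)) fun y => ?_
    rw [infObj_weakMap hPD, infObj_weakMap_restricted hPD _ _ _ hreg.2, qlrW2]
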